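/- Let $n\ge 2$, let $\delta$ be an indeterminate, and let $\Omega=\{\bullet,\blacktriangle,\circ,\vartriangle\}$, where $\bullet,\blacktriangle$ are called closed and $\circ,\vartriangle$ open decorations. **Diagrams.** A pseudo $(n+2)$-diagram is an isotopy class of finitely many disjoint curves in a rectangle with nodes $1,\dots,n+2$ on the north face and $1',\dots,(n+2)'$ on the south face: each node is an endpoint of exactly one curve, and the remaining curves are closed (loops). An edge joining the two faces is called propagating, and $\mathbf a(d)$ is the number of non-propagating edges of $d$ in the north face. A diagram is undammed if it has no propagating edge, and dammed otherwise. In an $\Omega$-decorated diagram $d$ each edge carries a finite sequence of elements of $\Omega$; on a loop this sequence is taken up to cyclic permutation and reversal. If $\mathbf a(d)=0$ there are no decorations. If $\mathbf a(d)=1$, the relative vertical order of the decorations on the propagating edges is part of the data (all these decorations lie below those of the non-propagating edge of the north face and above those of the non-propagating edge of the south face, and along each propagating edge they are met from top to bottom); a maximal block on a propagating edge is then a maximal run of decorations of that edge that are consecutive in this vertical order. In all other cases (non-propagating edges, loops, and propagating edges when $\mathbf a(d)\ne1$) all decorations of an edge form one maximal block. The place of a loop is disregarded where it is not determined by the decorations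 (it matters only for undecorated loops, which are replaced by $\delta$ below). **LR-decorated diagrams.** $d$ is LR-decorated if closed decorations occur only on edges (loops included) that can be deformed to touch the left wall without crossing other edges, open decorations only on edges that can be so deformed to touch the right wall, and the decorated edges can be deformed so as to take all closed decorations to the left wall and all open decorations to the right wall simultaneously. Let $\mathcal P^{LR}_{n+2}(\Omega)$ be the $\mathbb Z[\delta]$-algebra with the LR-decorated diagrams as a basis and with multiplication given by vertical concatenation. **The quotient.** Let $\widehat{\mathcal P}^{LR}_{n+2}(\Omega)$ be the quotient of $\mathcal P^{LR}_{n+2}(\Omega)$ by the two-sided ideal generated by the following local relations, which apply to adjacent decorations of one block on one edge: $$\bullet\bullet=\blacktriangle,\qquad \bullet\blacktriangle=\blacktriangle\bullet=2\,\bullet,\qquad \circ\circ=\vartriangle,\qquad \circ\vartriangle=\vartriangle\circ=2\,\circ,$$ together with the relations that an undecorated loop, a loop whose only decoration is one $\blacktriangle$, and a loop whose only decoration is one $\vartriangle$ may each be removed at the cost of a factor $\delta$. **Proposition.** The $\mathbb Z[\delta]$-module $\widehat{\mathcal P}^{LR}_{n+2}(\Omega)$ has as a basis the (pairwise distinct)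 images of those LR-decorated diagrams $d$ such that 1. no maximal block of $d$ contains two adjacent decorations of the same type (open or closed), where on loops adjacency is cyclic; equivalently, every non-empty maximal block is a non-identity basis element (an alternating product of open and closed decorations) of the decoration algebra $\mathcal V$, the quotient of the free algebra $\mathbb Z[\delta]\langle\Omega\rangle$ by $\bullet\bullet=\blacktriangle$, $\bullet\bullet\bullet=2\bullet$, $\circ\circ=\vartriangle$, $\circ\circ\circ=2\circ$; and 2. no loop of $d$ is undecorated or has a single $\blacktriangle$ or a single $\vartriangle$ as its only decoration. -/

import Mathlib

/-! ## Decorated pseudo diagrams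

The standard `k`-box has `k` nodes on its north face and `k` nodes on its south face.  A node is a
pair `(b, i)`; `b = false` is the north face, `b = true` is the south face, and `i : Fin k` counts
the nodes of a face from left to right. -/

/-- The nodes of the standard `k`-box. -/
abbrev BoxNode (k : ℕ) : Type := Bool × Fin k

/-- The `i`-th node of the north face. -/
abbrev north {k : ℕ} (i : Fin k) : BoxNode k := (false, i)

/-- The `i`-th node of the south face. -/
abbrev south {k : ℕ} (i : Fin k) : BoxNode k := (true, i)

/-- The place of a node on the boundary of the box, read clockwise from the left wall: along the
north face from left to right, past the right wall, along the south face from right to left. -/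
def posFromLeft {k : ℕ} (x : BoxNode k) : ℕ :=
  if x.1 then 2 * k - 1 - x.2 else x.2

/-- The place of a node on the boundary of the box, read clockwise from the right wall: along the
south face from right to left, past the left wall, along the north face from left to right. -/
def posFromRight {k : ℕ} (x : BoxNode k) : ℕ :=
  if x.1 then k - 1 - x.2 else k + x.2

/-- Loop equivalence: two words agree up to a cyclic permutation, possibly after reversing one. -/
def loopSetoid (X : Type) : Setoid (List X) where
  r u v := u.IsRotated v ∨ u.reverse.IsRotated v
  iseqv :=
    { refl := fun u => Or.inl (List.IsRotated.refl u)
      symm := by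
        rintro u v (h | h)
        · exact Or.inl h.symm
        · exact Or.inr (by simpa using h.reverse.symm)
      trans := by
        rintro u v w (h | h) (h' | h')
        · exact Or.inl (h.trans h')
        · exact Or.inr (h.reverse.trans h')
        · exact Or.inr (h.trans h')
        · exact Or.inl (by simpa using h.reverse.trans h') }

/-- The word of decorations on a loop: a word up to loop equivalence. -/
abbrev LoopWord (X : Type) : Type := Quotient (loopSetoid X)

/-- The loop word represented by a word. -/
def LoopWord.mk {X : Type} (u : List X) : LoopWord X := Quotient.mk (loopSetoid X) u

/-- The data of a `k`-box diagram with decorations in `X`, before planarity and the rules for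
decorations are imposed (see `IsDiagram`).

* `mate x` is the other end of the non-loop edge that starts at the node `x`;
* `word x` is the sequence of decorations met on that edge when it is traversed from `x`;
* `order` is used for diagrams with exactly one non-propagating edge in the north face only: it
  lists the decorations on all propagating edges by vertical position, from the highest to the
  lowest, each one with the (index of the) north node of its edge;
* `loops` is the collection of the loops, each recorded by the word of its decorations.  Where a
  loop lies need not be recorded: for a decorated loop of an LR-decorated diagram this is determined
  by the rest of the data (it is exposed on the side of its decorations, see `IsLR`), and an
  undecorated loop is replaced by the scalar `δ` in the quotient wherever it lies. -/
structure PreDiagram (X : Type) (k : ℕ) where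
  mate : BoxNode k → BoxNode k
  word : BoxNode k → List X
  order : List (Fin k × X)
  loops : Multiset (LoopWord X)

namespace PreDiagram

variable {X : Type} {k : ℕ}

/-- The edge at the node `x` is propagating: it joins the two faces. -/
def IsPropagating (d : PreDiagram X k) (x : BoxNode k) : Prop := (d.mate x).1 ≠ x.1

/-- A diagram is dammed if it has a propagating edge, and undammed otherwise. -/
def IsDammed (d : PreDiagram X k) : Prop := ∃ x, d.IsPropagating x

/-- The number of non-propagating edges in the north face. -/
def aValue (d : PreDiagram X k) : ℕ :=
  (Finset.univ.filter fun i : Fin k =>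
    (d.mate (north i)).1 = false ∧ i < (d.mate (north i)).2).card

/-- `d` is an `X`-decorated pseudo `k`-diagram.

* `mate` is a non-crossing perfect matching of the nodes;
* the word of an edge read from its other end is the reversed word;
* if the `a`-value is `0`, then there are no decorations;
* if the `a`-value is `1`, then the words of the propagating edges are the ones that can be
  read off from the vertical order of their decorations;
* if the `a`-value is not `1`, then vertical positions are not recorded. -/
structure IsDiagram (d : PreDiagram X k) : Prop where
  mate_mate : ∀ x, d.mate (d.mate x) = x
  mate_ne : ∀ x, d.mate x ≠ x
  noncrossing : ∀ x y, ¬ (posFromLeft x < posFromLeft y ∧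
    posFromLeft y < posFromLeft (d.mate x) ∧
    posFromLeft (d.mate x) < posFromLeft (d.mate y))
  word_mate : ∀ x, d.word (d.mate x) = (d.word x).reverse
  undecorated : d.aValue = 0 → (∀ x, d.word x = []) ∧ ∀ l ∈ d.loops, l = LoopWord.mk []
  order_isPropagating : ∀ p ∈ d.order, d.IsPropagating (north p.1)
  word_eq_order : d.aValue = 1 → ∀ i, d.IsPropagating (north i) →
    d.word (north i) = (d.order.filter fun p => p.1 = i).map Prod.snd
  order_eq_nil : d.aValue ≠ 1 → d.order = []

/-! ### Concatenation -/

/-- The diagram `E false` is placed on top of the diagram `E true`.  So the inner face of the box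
`b` is the face `!b`, its outer face is the face `b`, and the `i`-th inner nodes of the two boxes
coincide.  `walk E m b i` enters the box `b` at its `i`-th inner node and follows the edges
until an outer node is reached; it returns the decorations met and that outer node.  The number
`m` bounds the number of edges followed. -/
def walk (E : Bool → PreDiagram X k) : ℕ → Bool → Fin k → List X × BoxNode k
  | 0, b, i => ([], (b, i))
  | m + 1, b, i =>
    if ((E b).mate (!b, i)).1 = b then ((E b).word (!b, i), (E b).mate (!b, i))
    else
      ((E b).word (!b, i) ++ (walk E m (!b) ((E b).mate (!b, i)).2).1,
        (walk E m (!b) ((E b).mate (!b, i)).2).2)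

/-- The path that starts at an outer node `x`: the decorations met on it and its other end.
A path passes through each of the `k` pairs of inner nodes at most once. -/
def trace (E : Bool → PreDiagram X k) (x : BoxNode k) : List X × BoxNode k :=
  if ((E x.1).mate x).1 = x.1 then ((E x.1).word x, (E x.1).mate x)
  else
    ((E x.1).word x ++ (walk E k (!x.1) ((E x.1).mate x).2).1,
      (walk E k (!x.1) ((E x.1).mate x).2).2)

/-- Follow the edges from the inner node `i` into the bottom box; `some w` if this closes up to a
loop at the inner node `s` and all inner nodes met are at least `s`; then `w` is the word met. -/
def loopWalk (E : Bool → PreDiagram X k) (s : Fin k) : ℕ → Fin k → Option (List X)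
  | 0, _ => none
  | m + 1, i =>
    let y := (E true).mate (north i)
    let z := (E false).mate (south y.2)
    if y.1 = true ∨ z.1 = false ∨ y.2 < s ∨ z.2 < s then none
    else
      let w := (E true).word (north i) ++ (E false).word (south y.2)
      if z.2 = s then some w else (loopWalk E s m z.2).map (w ++ ·)

/-- The loops formed by concatenation, one for each inner node that is the smallest one on a
closed path. -/
def newLoops (E : Bool → PreDiagram X k) : Multiset (LoopWord X) :=
  ((Finset.univ : Finset (Fin k)).val.filterMap fun s => loopWalk E s k s).map LoopWord.mk

/-- Remove the decorations from the propagating edges. -/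
def stripPropagating (d : PreDiagram X k) : PreDiagram X k where
  mate := d.mate
  word x := if (d.mate x).1 = x.1 then d.word x else []
  order := []
  loops := d.loops

/-- The vertical order of the decorations on propagating edges after concatenation: those on
propagating edges of the top diagram, then those of non-propagating edges that have become part
of a propagating edge, then those on propagating edges of the bottom diagram. -/
def concatOrder (E : Bool → PreDiagram X k) : List (Fin k × X) :=
  (E false).order ++
  (List.finRange k).flatMap (fun i =>
    if (trace E (north i)).2.1 = true then
      (trace (fun b => (E b).stripPropagating) (north i)).1.map fun c => (i, c)
    else []) ++
  (E true).order.map fun p => ((walk E k false p.1).2.2, p.2)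

/-- Concatenation: `t` on top of `d`. -/
def concat (t d : PreDiagram X k) : PreDiagram X k :=
  let E : Bool → PreDiagram X k := fun b => if b then d else t
  let c : PreDiagram X k :=
    { mate := fun x => (trace E x).2
      word := fun x => (trace E x).1
      order := concatOrder E
      loops := t.loops + d.loops + newLoops E }
  { c with order := if c.aValue = 1 then c.order else [] }

instance : Mul (PreDiagram X k) := ⟨concat⟩

/-! ### Exposed edges -/

/-- The edge at `x` is L-exposed: no edge separates it from the left wall. -/
def LExposed (d : PreDiagram X k) (x : BoxNode k) : Prop :=
  ∀ y, ¬ (posFromLeft y < posFromLeft x ∧ posFromLeft x < posFromLeft (d.mate y))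

/-- The edge at `x` is R-exposed: no edge separates it from the right wall. -/
def RExposed (d : PreDiagram X k) (x : BoxNode k) : Prop :=
  ∀ y, ¬ (posFromRight y < posFromRight x ∧ posFromRight x < posFromRight (d.mate y))

/-- All decorations on the non-propagating edges of the face `b`, read from left to right: edge by
edge, each edge from its left end to its right end. -/
def faceWord (d : PreDiagram X k) (b : Bool) : List X :=
  (List.finRange k).flatMap fun i =>
    if (d.mate (b, i)).1 = b ∧ i < (d.mate (b, i)).2 then d.word (b, i) else []

end PreDiagram

/-! ## The decoration set and LR-decorated diagrams -/

/-- The decoration set `Ω`: the closed decorations `•`, `▲` and the open ones `∘`, `△`. -/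
inductive Omega : Type
  | bullet
  | closedTri
  | circ
  | openTri
  deriving DecidableEq

/-- The decorations `•` and `▲` are closed, the decorations `∘` and `△` are open. -/
def Omega.isClosed : Omega → Bool
  | .bullet => true
  | .closedTri => true
  | .circ => false
  | .openTri => false

/-- `d` is an LR-decorated diagram: closed decorations sit on L-exposed edges, open decorations on
R-exposed edges, and all closed decorations can be moved to the left wall and all open ones to the
right wall simultaneously.

A decorated loop of a dammed diagram lies to the left of all propagating edges or to the right of
all of them, so it cannot have decorations of both types.  If the diagram is undammed, then all
exposed edges and decorated loops lie around one region that touches both walls; there the closed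
decorations must come before the open ones along the north face, along the south face, and (from a
suitable starting point, in one of the two directions) along each loop. -/
structure IsLR {k : ℕ} (d : PreDiagram Omega k) : Prop extends d.IsDiagram where
  closed_exposed : ∀ x, ∀ c ∈ d.word x, c.isClosed = true → d.LExposed x
  open_exposed : ∀ x, ∀ c ∈ d.word x, c.isClosed = false → d.RExposed x
  face_sorted : ¬ d.IsDammed → ∀ b,
    (d.faceWord b).Pairwise fun c c' => c'.isClosed = true → c.isClosed = true
  loop_sorted : ∀ l ∈ d.loops, ∃ u v : List Omega, l = LoopWord.mk (u ++ v) ∧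
    (∀ c ∈ u, c.isClosed = true) ∧ (∀ c ∈ v, c.isClosed = false) ∧
    (d.IsDammed → u = [] ∨ v = [])

/-! ## The algebra of LR-decorated diagrams and its quotient -/

noncomputable section

/-- The free `ℤ[δ]`-module on the (pre)diagrams, with the bilinear extension of concatenation;
the indeterminate `δ` is `Polynomial.X`. -/
abbrev DiagramModule (k : ℕ) : Type := MonoidAlgebra (Polynomial ℤ) (PreDiagram Omega k)

/-- A diagram as an element of `DiagramModule k`. -/
def ofDiagram {k : ℕ} (d : PreDiagram Omega k) : DiagramModule k :=
  MonoidAlgebra.single d 1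

/-- The span `P^LR` of the LR-decorated diagrams. -/
def lrSpan (k : ℕ) : Submodule (Polynomial ℤ) (DiagramModule k) :=
  Submodule.span (Polynomial ℤ) (ofDiagram '' {d | IsLR d})

/-- The relations between adjacent decorations of one block: `BlockRel u m v` stands for the
relation `u = m v`. -/
inductive BlockRel : List Omega → ℤ → List Omega → Prop
  | closed_two : BlockRel [.bullet, .bullet] 1 [.closedTri]
  | closed_three : BlockRel [.bullet, .closedTri] 2 [.bullet]
  | closed_three' : BlockRel [.closedTri, .bullet] 2 [.bullet]
  | open_two : BlockRel [.circ, .circ] 1 [.openTri]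
  | open_three : BlockRel [.circ, .openTri] 2 [.circ]
  | open_three' : BlockRel [.openTri, .circ] 2 [.circ]

/-- The words of the loops that are replaced by the scalar `δ`. -/
inductive ScalarLoop : List Omega → Prop
  | plain : ScalarLoop []
  | closedTri : ScalarLoop [.closedTri]
  | openTri : ScalarLoop [.openTri]

/-- All decorations on the edge at `x` belong to a single maximal block.  This fails only for
propagating edges of diagrams with `a`-value `1`. -/
def IsSingleBlock {k : ℕ} (d : PreDiagram Omega k) (x : BoxNode k) : Prop :=
  d.aValue = 1 → ¬ d.IsPropagating x

/-- The local relations: `DiagramRel d c d'` stands for the relation `d = c d'`.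

* `edge`: a block relation on an edge whose decorations form a single maximal block;
* `block`: a block relation within a block on the propagating edge at the `i`-th north node of a
  diagram with `a`-value `1`; adjacent decorations of one block are consecutive in `order`;
* `loop`: a block relation on a loop;
* `removal`: a loop that is undecorated, or has a single `▲` or `△`, is replaced by `δ`. -/
inductive DiagramRel {k : ℕ} : PreDiagram Omega k → Polynomial ℤ → PreDiagram Omega k → Prop
  | edge (d d' : PreDiagram Omega k) (x : BoxNode k) (p u q v : List Omega) (m : ℤ)
      (hrel : BlockRel u m v) (hx : IsSingleBlock d x)
      (hmate : d'.mate = d.mate) (horder : d'.order = d.order) (hloops : d'.loops = d.loops)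
      (hword : d.word x = p ++ u ++ q) (hword' : d'.word x = p ++ v ++ q)
      (hmateword : d'.word (d.mate x) = (d'.word x).reverse)
      (hother : ∀ y, y ≠ x → y ≠ d.mate x → d'.word y = d.word y) :
      DiagramRel d (Polynomial.C m) d'
  | block (d d' : PreDiagram Omega k) (i : Fin k) (p q : List (Fin k × Omega))
      (u v : List Omega) (m : ℤ)
      (hrel : BlockRel u m v) (ha : d.aValue = 1)
      (hmate : d'.mate = d.mate) (hloops : d'.loops = d.loops)
      (horder : d.order = p ++ u.map (fun c => (i, c)) ++ q)
      (horder' : d'.order = p ++ v.map (fun c => (i, c)) ++ q)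
      (hother : ∀ y, ¬ d.IsPropagating y → d'.word y = d.word y) :
      DiagramRel d (Polynomial.C m) d'
  | loop (d d' : PreDiagram Omega k) (p u v : List Omega) (L : Multiset (LoopWord Omega)) (m : ℤ)
      (hrel : BlockRel u m v)
      (hmate : d'.mate = d.mate) (horder : d'.order = d.order) (hword : d'.word = d.word)
      (hloops : d.loops = LoopWord.mk (p ++ u) ::ₘ L)
      (hloops' : d'.loops = LoopWord.mk (p ++ v) ::ₘ L) :
      DiagramRel d (Polynomial.C m) d'
  | removal (d d' : PreDiagram Omega k) (w : List Omega)
      (hw : ScalarLoop w)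
      (hmate : d'.mate = d.mate) (horder : d'.order = d.order) (hword : d'.word = d.word)
      (hloops : d.loops = LoopWord.mk w ::ₘ d'.loops) :
      DiagramRel d Polynomial.X d'

/-- The two-sided ideal of `P^LR` generated by the local relations between LR-decorated diagrams:
the smallest submodule that contains them and is stable under left and right multiplication by
elements of `P^LR`. -/
def relationIdeal (k : ℕ) : Submodule (Polynomial ℤ) (DiagramModule k) :=
  sInf {J | (∀ d c d', IsLR d → IsLR d' → DiagramRel d c d' →
      ofDiagram d - c • ofDiagram d' ∈ J) ∧
    ∀ x ∈ J, ∀ y ∈ lrSpan k, y * x ∈ J ∧ x * y ∈ J}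

/-- The additive group structure of the submodule `P^LR`, as Mathlib defines it. -/
instance lrSpanAddCommGroup (k : ℕ) : AddCommGroup (lrSpan k) := Submodule.addCommGroup _

/-- The quotient of `P^LR` by the ideal generated by the local relations. -/
abbrev QuotientAlgebra (k : ℕ) : Type :=
  lrSpan k ⧸ (relationIdeal k).submoduleOf (lrSpan k)

/-- The image of an LR-decorated diagram in the quotient. -/
def diagramClass {k : ℕ} (d : PreDiagram Omega k) (hd : IsLR d) : QuotientAlgebra k :=
  Submodule.Quotient.mk ⟨ofDiagram d, Submodule.subset_span ⟨d, hd, rfl⟩⟩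

/-- No two adjacent decorations have the same type (open or closed). -/
def IsAlternating (w : List Omega) : Prop :=
  w.IsChain fun c c' => c.isClosed ≠ c'.isClosed

/-- `d` is an LR-decorated diagram in which no maximal block has two adjacent decorations of the
same type, and no loop is undecorated or has a single `▲` or a single `△` as its only decoration.
On a loop, adjacency is cyclic, so all words that represent it must alternate. -/
structure IsBasisDiagram {k : ℕ} (d : PreDiagram Omega k) : Prop extends IsLR d where
  edge_alternating : ∀ x, IsSingleBlock d x → IsAlternating (d.word x)
  block_alternating :
    d.order.IsChain fun p p' => p.1 = p'.1 → p.2.isClosed ≠ p'.2.isClosed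
  loop_alternating : ∀ w, LoopWord.mk w ∈ d.loops → IsAlternating w
  not_scalarLoop : ∀ w, LoopWord.mk w ∈ d.loops → ¬ ScalarLoop w

end

/-! Each local relation turns a diagram into a scalar multiple of a single diagram.

Spanning is therefore a termination argument. A diagram that violates a basis condition has two
adjacent decorations of the same type in one block or on a loop, or a removable loop. In each case
it is a multiple of an LR-decorated diagram with fewer decorations or loops
(`IsLR.isBasisDiagram_or_exists_reduces`).

For independence, an invariant replaces confluence of the rewriting. The `shape` of a diagram keeps
the matching, the words and the vertical order up to the block relations without their coefficients,
and the parity contents of the loops that are not scalar. Without coefficients, the decorations of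
one type form `ZMod 2` with a new identity adjoined, and words live in a free product of such
monoids. Uniqueness of reduced words in the free product shows that basis diagrams have different
shapes (`eq_of_shape_eq`).

The lost coefficients are recorded by `scalar`. If `•` and `∘` weigh `√2` and `▲` and `△` weigh `2`,
every block relation is balanced; a removable loop contributes an extra `δ`, divided by its weight.
Since a product over nodes sees each edge from both ends, the letters get the square roots `κ` and
`κ ^ 2`, with `κ ^ 4 = 2`, over an algebraic closure of the fraction field of `ℤ[δ]`.

It must be shown that `d ↦ scalar d • [shape d]` kills the ideal and not just its generators. Two
facts about concatenation suffice: the shape of a product, and the contents of its new loops, depend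
only on the shapes of the factors (`shape_concat_congr`); and the total weight is multiplicative
(`content_concat`). The second one holds because the open paths and the closed paths together run
through every edge of the two boxes once in each direction; the analysis of paths serves to prove
this. The map then sends the classes of basis diagrams to non-zero multiples of distinct basis
vectors. -/

/-! ## Paths in a pair of boxes -/

/-- The edges of `d` are the orbits of a fixed-point-free involution of the nodes, and the words
read from the two ends of an edge are the reverses of each other. -/
structure PreDiagram.IsMatched {X : Type} {k : ℕ} (d : PreDiagram X k) : Prop where
  mate_mate : ∀ x, d.mate (d.mate x) = x
  mate_ne : ∀ x, d.mate x ≠ x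
  word_mate : ∀ x, d.word (d.mate x) = (d.word x).reverse

theorem PreDiagram.IsDiagram.isMatched {X : Type} {k : ℕ} {d : PreDiagram X k}
    (h : d.IsDiagram) : d.IsMatched :=
  ⟨h.mate_mate, h.mate_ne, h.word_mate⟩

namespace PairPath

open PreDiagram Function

variable {X : Type} {k : ℕ}

/-- The nodes of two stacked boxes: a box, a face of that box and the index of a node on it.  The
node is outer if the box and the face agree, and inner otherwise. -/
abbrev PairNode (k : ℕ) : Type := Bool × BoxNode k

/-- The other end of the edge at a node. -/
def along (E : Bool → PreDiagram X k) (v : PairNode k) : PairNode k := (v.1, (E v.1).mate v.2)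

/-- The identification of the inner nodes of the two boxes; the outer nodes are fixed. -/
def glue (v : PairNode k) : PairNode k := (v.2.1, v.1, v.2.2)

/-- Follow an edge and cross to the other box if its end is an inner node. -/
def next (E : Bool → PreDiagram X k) (v : PairNode k) : PairNode k := glue (along E v)

/-- The word on the edge at a node. -/
def nodeWord (E : Bool → PreDiagram X k) (v : PairNode k) : List X := (E v.1).word v.2

/-- The word met on the first `n` edges of the path from a node. -/
def pathWord (E : Bool → PreDiagram X k) : ℕ → PairNode k → List X
  | 0, _ => []
  | n + 1, v => nodeWord E v ++ pathWord E n (next E v)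

/-- The node lies on the common face of the two boxes. -/
def Inner (v : PairNode k) : Prop := v.2.1 ≠ v.1

/-- An outer node of the pair of boxes. -/
def outerNode (x : BoxNode k) : PairNode k := (x.1, x)

@[simp] theorem glue_glue (v : PairNode k) : glue (glue v) = v := rfl

theorem glue_injective : Injective (glue (k := k)) :=
  (show Involutive (glue (k := k)) from glue_glue).injective

theorem glue_eq_self_of_not_inner {v : PairNode k} (h : ¬ Inner v) : glue v = v := by
  obtain ⟨b, f, i⟩ := v
  simp only [Inner, not_not] at h
  subst h
  rfl

theorem inner_glue {v : PairNode k} : Inner (glue v) ↔ Inner v := ne_comm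

theorem not_inner_outerNode (x : BoxNode k) : ¬ Inner (outerNode x) := fun h => h rfl

theorem outerNode_of_not_inner {v : PairNode k} (h : ¬ Inner v) : outerNode v.2 = v := by
  obtain ⟨b, f, i⟩ := v
  simp only [Inner, not_not] at h
  subst h
  rfl

theorem glue_outerNode (x : BoxNode k) : glue (outerNode x) = outerNode x := rfl

theorem outerNode_injective : Injective (outerNode (k := k)) := fun _ _ h => congrArg Prod.snd h

variable {E : Bool → PreDiagram X k}

theorem along_along (hE : ∀ b, (E b).IsMatched) (v : PairNode k) :
    along E (along E v) = v := by
  simp [along, (hE v.1).mate_mate]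

theorem along_ne (hE : ∀ b, (E b).IsMatched) (v : PairNode k) : along E v ≠ v := fun h =>
  (hE v.1).mate_ne v.2 (congrArg Prod.snd h)

theorem nodeWord_along (hE : ∀ b, (E b).IsMatched) (v : PairNode k) :
    nodeWord E (along E v) = (nodeWord E v).reverse :=
  (hE v.1).word_mate v.2

theorem next_injective (hE : ∀ b, (E b).IsMatched) : Injective (next E) :=
  glue_injective.comp (show Involutive (along E) from along_along hE).injective

theorem glue_next (v : PairNode k) : glue (next E v) = along E v := rfl

theorem next_along (hE : ∀ b, (E b).IsMatched) (v : PairNode k) :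
    next E (along E v) = glue v := by
  rw [next, along_along hE]

/-- Following a path backwards. -/
theorem iterate_next_glue (hE : ∀ b, (E b).IsMatched) (n : ℕ) (v : PairNode k) :
    (next E)^[n] (glue ((next E)^[n] v)) = glue v := by
  induction n generalizing v with
  | zero => rfl
  | succ n ih =>
    rw [iterate_succ_apply, iterate_succ_apply', glue_next, next_along hE, ih]

/-- A path that comes back along its first edge is a palindrome. Peeling off its first and last
edges leads to its middle, which is either an edge with equal ends or a turn at an outer node; both
are excluded. -/
theorem iterate_next_ne_along (hE : ∀ b, (E b).IsMatched) (m : ℕ) (v : PairNode k)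
    (h : ∀ j, 0 < j → j ≤ m → Inner ((next E)^[j] v)) : (next E)^[m] v ≠ along E v := by
  induction m using Nat.twoStepInduction generalizing v with
  | zero => exact (along_ne hE v).symm
  | one =>
    intro h1
    refine h 1 one_pos le_rfl ?_
    have h2 : glue (along E v) = along E v := h1
    rw [h1]
    exact (congrArg Prod.fst h2)
  | more m ih _ =>
    intro h1
    refine ih (next E v) (fun j h0 hj => h (j + 1) (by omega) (by omega)) ?_
    rw [iterate_succ_apply', iterate_succ_apply] at h1
    have h2 := congrArg glue h1
    rw [glue_next] at h2
    have h3 := congrArg (along E) h2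
    rwa [along_along hE] at h3

theorem pathWord_succ (n : ℕ) (v : PairNode k) :
    pathWord E (n + 1) v = pathWord E n v ++ nodeWord E ((next E)^[n] v) := by
  induction n generalizing v with
  | zero => simp [pathWord]
  | succ n ih => rw [pathWord, ih, pathWord, List.append_assoc, iterate_succ_apply]

theorem pathWord_glue (hE : ∀ b, (E b).IsMatched) (n : ℕ) (v : PairNode k) :
    pathWord E n (glue ((next E)^[n] v)) = (pathWord E n v).reverse := by
  induction n with
  | zero => rfl
  | succ n ih =>
    rw [pathWord_succ n v, pathWord, iterate_succ_apply', glue_next, next_along hE, ih,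
      nodeWord_along hE, List.reverse_append]

theorem prod_map_pathWord {M : Type*} [CommMonoid M] (g : X → M) (n : ℕ) (v : PairNode k) :
    ((pathWord E n v).map g).prod =
      ∏ j ∈ Finset.range n, ((nodeWord E ((next E)^[j] v)).map g).prod := by
  induction n with
  | zero => simp [pathWord]
  | succ n ih => rw [pathWord_succ, Finset.prod_range_succ, ← ih]; simp

/-! ### Traces -/

theorem walk_eq (m n : ℕ) (v : PairNode k) (hnm : n ≤ m)
    (hin : ∀ j < n, Inner ((next E)^[j] v)) (hout : ¬ Inner ((next E)^[n] v)) (hv : Inner v) :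
    walk E m v.1 v.2.2 = (pathWord E n v, ((next E)^[n] v).2) := by
  induction m generalizing n v with
  | zero => obtain rfl : n = 0 := by omega
            exact absurd hv hout
  | succ m ih =>
    obtain ⟨b, f, i⟩ := v
    obtain rfl : f = !b := by simpa [Inner, Bool.eq_not] using hv
    cases n with
    | zero => exact absurd hv hout
    | succ n =>
      by_cases hb : ((E b).mate (!b, i)).1 = b
      · have h1 : ¬ Inner (next E (b, !b, i)) := by
          simp [Inner, next, glue, along, hb]
        have hn : n = 0 := by
          by_contra h0
          exact h1 (hin 1 (by omega))
        subst hn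
        have h2 : next E (b, !b, i) = along E (b, !b, i) := by
          refine glue_eq_self_of_not_inner ?_
          simp [Inner, along, hb]
        simp [walk, hb, pathWord, nodeWord, h2, along]
      · have hb' : ((E b).mate (!b, i)).1 = !b := by
          simpa [Bool.eq_not] using hb
        have h2 : next E (b, !b, i) = (!b, b, ((E b).mate (!b, i)).2) := by
          simp [next, glue, along, hb']
        have := ih n (next E (b, !b, i)) (by omega) (fun j hj => hin (j + 1) (by omega)) hout
          (by simp [h2, Inner])
        rw [h2] at this
        simp only [walk, hb, if_false, this, pathWord, nodeWord, h2, iterate_succ_apply]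

/-- The inner nodes on a path between outer nodes have pairwise distinct indices. -/
theorem return_time_le (hE : ∀ b, (E b).IsMatched) (n : ℕ) (v : PairNode k) (hv : ¬ Inner v)
    (hin : ∀ j, 0 < j → j < n → Inner ((next E)^[j] v)) : n ≤ k + 1 := by
  have hinj : ∀ i j, i < j → j + 1 < n →
      ((next E)^[i + 1] v).2.2 ≠ ((next E)^[j + 1] v).2.2 := by
    intro i j hij hjn h
    set a := (next E)^[i + 1] v with ha
    set c := (next E)^[j + 1] v with hc
    have ha1 : Inner a := hin _ (by omega) (by omega)
    have hc1 : Inner c := hin _ (by omega) (by omega)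
    -- There are only two inner nodes with a given index, one in each box. If the same one recurs,
    -- rewinding the path makes its outer start inner; if both occur, the path runs backwards along
    -- an edge.
    have hcase : c = a ∨ c = glue a := by
      obtain ⟨b, f, i⟩ := a
      obtain ⟨b', f', i'⟩ := c
      simp only [Inner] at ha1 hc1 h
      subst h
      revert ha1 hc1
      cases b <;> cases f <;> cases b' <;> cases f' <;> simp [glue]
    rcases hcase with h | h
    · have h3 : (next E)^[i + 1] ((next E)^[j - i] v) = (next E)^[i + 1] v := by
        rw [← iterate_add_apply, show i + 1 + (j - i) = j + 1 by omega, ← hc, h]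
      have h4 := (next_injective hE).iterate _ h3
      exact absurd (h4 ▸ hin (j - i) (by omega) (by omega)) hv
    · refine iterate_next_ne_along hE (j + 1 - i) ((next E)^[i] v) (fun t h0 ht => ?_) ?_
      · rw [← iterate_add_apply]
        exact hin _ (by omega) (by omega)
      · rw [← iterate_add_apply, show j + 1 - i + i = j + 1 by omega, ← hc, h, ha,
          iterate_succ_apply', glue_next]
  have hinj' : Injective fun j : Fin (n - 1) => ((next E)^[j.1 + 1] v).2.2 := by
    intro i j h
    by_contra hne
    rcases lt_or_gt_of_ne (fun h' => hne (Fin.ext h') : i.1 ≠ j.1) with h' | h'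
    · exact hinj _ _ h' (by omega) h
    · exact hinj _ _ h' (by omega) h.symm
  have := Fintype.card_le_of_injective _ hinj'
  simp only [Fintype.card_fin] at this
  omega

/-- The fuel never runs out: `trace` follows one edge itself and leaves at most `k` to `walk`, which
matches the bound `k + 1` on the return time. -/
theorem trace_eq (hE : ∀ b, (E b).IsMatched) (n : ℕ) (x : BoxNode k) (hn : 0 < n)
    (hin : ∀ j, 0 < j → j < n → Inner ((next E)^[j] (outerNode x)))
    (hout : ¬ Inner ((next E)^[n] (outerNode x))) :
    trace E x = (pathWord E n (outerNode x), ((next E)^[n] (outerNode x)).2) := by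
  have hle := return_time_le hE n _ (not_inner_outerNode x) hin
  obtain ⟨n, rfl⟩ : ∃ m, n = m + 1 := ⟨n - 1, by omega⟩
  by_cases hb : ((E x.1).mate x).1 = x.1
  · have h1 : ¬ Inner (next E (outerNode x)) := by
      simp [Inner, next, glue, along, outerNode, hb]
    have hn : n = 0 := by
      by_contra h0
      exact h1 (hin 1 (by omega) (by omega))
    subst hn
    have h2 : next E (outerNode x) = along E (outerNode x) := by
      refine glue_eq_self_of_not_inner ?_
      simp [Inner, along, outerNode, hb]
    simp only [trace, hb, if_true, pathWord, List.append_nil, zero_add, iterate_one, h2]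
    rfl
  · have hb' : ((E x.1).mate x).1 = !x.1 := by simpa [Bool.eq_not] using hb
    have h2 : next E (outerNode x) = (!x.1, x.1, ((E x.1).mate x).2) := by
      simp [next, glue, along, outerNode, hb']
    have h3 : Inner (next E (outerNode x)) := by simp [h2, Inner]
    have := walk_eq k n (next E (outerNode x)) (by omega)
      (fun j hj => hin (j + 1) (by omega) (by omega)) hout h3
    rw [h2] at this
    simp only [trace, hb, if_false, this, pathWord, nodeWord, h2, iterate_succ_apply]
    rfl

/-- An injective self-map of a finite set has only periodic points. Paths are thus continued past
outer nodes into closed orbits. -/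
theorem exists_iterate_eq (hE : ∀ b, (E b).IsMatched) (v : PairNode k) :
    ∃ n, 0 < n ∧ (next E)^[n] v = v :=
  (next_injective hE).mem_periodicPts v

theorem exists_return_time (hE : ∀ b, (E b).IsMatched) (x : BoxNode k) :
    ∃ n, 0 < n ∧ (∀ j, 0 < j → j < n → Inner ((next E)^[j] (outerNode x))) ∧
      ¬ Inner ((next E)^[n] (outerNode x)) := by
  classical
  have h : ∃ n, 0 < n ∧ ¬ Inner ((next E)^[n] (outerNode x)) := by
    obtain ⟨n, hn, h⟩ := exists_iterate_eq hE (outerNode x)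
    exact ⟨n, hn, by rw [h]; exact not_inner_outerNode x⟩
  refine ⟨Nat.find h, (Nat.find_spec h).1, fun j h0 hj => ?_, (Nat.find_spec h).2⟩
  by_contra hc
  exact Nat.find_min h hj ⟨h0, hc⟩

theorem trace_spec (hE : ∀ b, (E b).IsMatched) (x : BoxNode k) :
    ∃ n, 0 < n ∧ (∀ j, 0 < j → j < n → Inner ((next E)^[j] (outerNode x))) ∧
      (next E)^[n] (outerNode x) = outerNode (trace E x).2 ∧
      (trace E x).1 = pathWord E n (outerNode x) := by
  obtain ⟨n, h0, hin, hout⟩ := exists_return_time hE x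
  have := trace_eq hE n x h0 hin hout
  exact ⟨n, h0, hin, by rw [this, outerNode_of_not_inner hout], by rw [this]⟩

/-- A path returning to its start would do so along its first edge, reversed. -/
theorem trace_snd_ne (hE : ∀ b, (E b).IsMatched) (x : BoxNode k) : (trace E x).2 ≠ x := by
  obtain ⟨n, h0, hin, hout, -⟩ := trace_spec hE x
  intro h
  rw [h] at hout
  obtain ⟨n, rfl⟩ : ∃ m, n = m + 1 := ⟨n - 1, by omega⟩
  refine iterate_next_ne_along hE n (outerNode x) (fun j h0 hj => hin j h0 (by omega)) ?_
  rw [iterate_succ_apply'] at hout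
  have h2 := congrArg glue hout
  rw [glue_next, glue_outerNode] at h2
  have h3 := congrArg (along E) h2
  rwa [along_along hE] at h3

/-- Read backwards, the path visits the glued images of its nodes, and gluing preserves inner nodes.
So the return time is the same in both directions. -/
theorem trace_trace (hE : ∀ b, (E b).IsMatched) (x : BoxNode k) :
    trace E (trace E x).2 = ((trace E x).1.reverse, x) := by
  obtain ⟨n, h0, hin, hout, hw⟩ := trace_spec hE x
  have hback : ∀ j ≤ n, (next E)^[j] (outerNode (trace E x).2) =
      glue ((next E)^[n - j] (outerNode x)) := by
    intro j hj
    have h1 := iterate_next_glue hE j ((next E)^[n - j] (outerNode x))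
    rwa [← iterate_add_apply, Nat.add_sub_cancel' hj, hout, glue_outerNode] at h1
  have hn : (next E)^[n] (outerNode (trace E x).2) = outerNode x := by
    rw [hback n le_rfl, Nat.sub_self]; rfl
  have := trace_eq hE n (trace E x).2 h0
    (fun j h0 hj => by
      rw [hback j hj.le, inner_glue]; exact hin _ (by omega) (by omega))
    (by rw [hn]; exact not_inner_outerNode x)
  rw [this, hn, hw, ← pathWord_glue hE, hout, glue_outerNode]
  rfl

end PairPath

/-- Invariance under multiplication needs only this much structure, so products are never shown to
be planar or LR-decorated. -/
theorem PreDiagram.IsMatched.concat {X : Type} {k : ℕ} {t d : PreDiagram X k}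
    (ht : t.IsMatched) (hd : d.IsMatched) : (t.concat d).IsMatched := by
  have hE : ∀ b : Bool, (if b then d else t : PreDiagram X k).IsMatched := by
    rintro (_ | _) <;> assumption
  exact ⟨fun x => congrArg Prod.snd (PairPath.trace_trace hE x), PairPath.trace_snd_ne hE,
    fun x => congrArg Prod.fst (PairPath.trace_trace hE x)⟩

/-! ## Multiplicative invariants of concatenation -/

/-- The product of the values of `g` at the letters of a loop word. -/
def LoopWord.content {X M : Type} [CommMonoid M] (g : X → M) : LoopWord X → M :=
  Quotient.lift (fun u => (u.map g).prod) fun u v h => by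
    rcases h with h | h
    · exact (h.perm.map g).prod_eq
    · rw [← (h.perm.map g).prod_eq, ((List.reverse_perm u).map g).prod_eq]

@[simp] theorem LoopWord.content_mk {X M : Type} [CommMonoid M] (g : X → M) (u : List X) :
    (LoopWord.mk u).content g = (u.map g).prod := rfl

/-- The product of the values of `g` at all decorations of a diagram, each one counted twice. -/
def PreDiagram.content {X M : Type} {k : ℕ} [CommMonoid M] (g : X → M) (d : PreDiagram X k) : M :=
  (∏ x, ((d.word x).map g).prod) * (d.loops.map (LoopWord.content g)).prod ^ 2

namespace PairPath

open PreDiagram Function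

variable {X : Type} {k : ℕ} {E : Bool → PreDiagram X k}

/-- The product of the values of `g` at the letters on the edge of a node. -/
def nodeContent {M : Type} [CommMonoid M] (g : X → M) (E : Bool → PreDiagram X k)
    (v : PairNode k) : M :=
  ((nodeWord E v).map g).prod

/-! ### Reachability, and the count of nodes on open paths. -/

/-- `w` lies on the path that starts at `v`. -/
def Reaches (E : Bool → PreDiagram X k) (v w : PairNode k) : Prop := ∃ n, (next E)^[n] v = w

theorem Reaches.refl (v : PairNode k) : Reaches E v v := ⟨0, rfl⟩

theorem reaches_next (v : PairNode k) : Reaches E v (next E v) := ⟨1, rfl⟩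

theorem Reaches.trans {u v w : PairNode k} (h : Reaches E u v) (h' : Reaches E v w) :
    Reaches E u w := by
  obtain ⟨m, rfl⟩ := h
  obtain ⟨n, rfl⟩ := h'
  exact ⟨n + m, iterate_add_apply _ _ _ _⟩

theorem Reaches.symm (hE : ∀ b, (E b).IsMatched) {u v : PairNode k} (h : Reaches E u v) :
    Reaches E v u := by
  obtain ⟨m, rfl⟩ := h
  obtain ⟨p, hp, h⟩ := exists_iterate_eq hE u
  refine ⟨p * m - m, ?_⟩
  rw [← iterate_add_apply, Nat.sub_add_cancel (Nat.le_mul_of_pos_left m hp), iterate_mul]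
  exact iterate_fixed h m

theorem Reaches.glue (hE : ∀ b, (E b).IsMatched) {u v : PairNode k} (h : Reaches E u v) :
    Reaches E (PairPath.glue u) (PairPath.glue v) := by
  obtain ⟨m, rfl⟩ := h
  exact Reaches.symm hE ⟨m, iterate_next_glue hE m u⟩

/-- The node lies on a path that ends at an outer node. -/
def Through (E : Bool → PreDiagram X k) (v : PairNode k) : Prop :=
  ∃ w, Reaches E v w ∧ ¬ Inner w

/-- A closed path and its reverse are disjoint orbits of `next`; this makes the count of the nodes
on loops exact. -/
theorem not_reaches_along (hE : ∀ b, (E b).IsMatched) {v : PairNode k} (hv : ¬ Through E v) :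
    ¬ Reaches E v (along E v) := by
  rintro ⟨m, h⟩
  exact iterate_next_ne_along hE m v
    (fun j _ _ => by_contra fun hc => hv ⟨_, ⟨j, rfl⟩, hc⟩) h

theorem not_reaches_glue (hE : ∀ b, (E b).IsMatched) {v : PairNode k} (hv : ¬ Through E v) :
    ¬ Reaches E v (glue v) := by
  intro h
  refine not_reaches_along hE hv (h.trans ((Reaches.symm hE ?_)))
  rw [← next_along hE]
  exact reaches_next _

theorem not_through_of_reaches {v w : PairNode k}
    (h : Reaches E v w) (hv : ¬ Through E v) : ¬ Through E w :=
  fun ⟨u, hu, hu'⟩ => hv ⟨u, h.trans hu, hu'⟩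

/-- The paths that start at the outer nodes run exactly once through each node from which an
outer node can be reached. -/
theorem prod_trace {M : Type} [CommMonoid M] (g : X → M) (hE : ∀ b, (E b).IsMatched) :
    open Classical in
    ∏ x, ((trace E x).1.map g).prod =
      ∏ v ∈ Finset.univ.filter (Through E), nodeContent g E v := by
  classical
  choose n h0 hin hout hw using trace_spec hE
  have hlast : ∀ x, ¬ Inner ((next E)^[n x] (outerNode x)) := fun x => by
    rw [hout]; exact not_inner_outerNode _
  simp_rw [hw, prod_map_pathWord]
  rw [Finset.prod_sigma']
  -- The bijection sends `(x, j)` with `j < n x` to the `j`-th node on the path from `x`. The final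
  -- outer node is left out, since it starts the reversed path.
  refine Finset.prod_nbij (fun p => (next E)^[p.2] (outerNode p.1)) ?_ ?_ ?_ ?_
  · rintro ⟨x, j⟩ hp
    simp only [Finset.mem_sigma, Finset.mem_univ, Finset.mem_range, true_and] at hp
    simp only [Finset.mem_filter, Finset.mem_univ, true_and]
    refine ⟨_, ⟨n x - j, rfl⟩, ?_⟩
    rw [← iterate_add_apply, Nat.sub_add_cancel hp.le]
    exact hlast x
  · have key : ∀ x x' j j', j ≤ j' → j' < n x' →
        (next E)^[j] (outerNode x) = (next E)^[j'] (outerNode x') → x = x' ∧ j = j' := by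
      intro x x' j j' hjj hj h
      rw [← Nat.add_sub_cancel' hjj, iterate_add_apply] at h
      have h1 := (next_injective hE).iterate _ h
      have h2 : j' - j = 0 := by
        by_contra h3
        refine not_inner_outerNode x ?_
        rw [h1]
        exact hin x' _ (by omega) (by omega)
      rw [h2] at h1
      exact ⟨outerNode_injective h1, by omega⟩
    rintro ⟨x, j⟩ hp ⟨x', j'⟩ hp' h
    simp only [Finset.coe_sigma, Set.mem_sigma_iff, Finset.coe_univ, Set.mem_univ, true_and,
      Finset.coe_range, Set.mem_Iio] at hp hp'
    rcases le_total j j' with hjj | hjj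
    · obtain ⟨rfl, rfl⟩ := key x x' j j' hjj hp' h
      rfl
    · obtain ⟨rfl, rfl⟩ := key x' x j' j hjj hp h.symm
      rfl
  · intro v hv
    simp only [Finset.coe_filter, Finset.mem_univ, true_and, Set.mem_ofPred_eq] at hv
    obtain ⟨w, hvw, hw'⟩ := hv
    have hex : ∃ i, ∃ x, (next E)^[i] (outerNode x) = v := by
      obtain ⟨i, hi⟩ := hvw.symm hE
      exact ⟨i, w.2, by rw [outerNode_of_not_inner hw', hi]⟩
    obtain ⟨x, hx⟩ := Nat.find_spec hex
    -- The outer start is chosen with as few steps to `v` as possible. If `v` came after the end of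
    -- the first path, that end would be a closer start.
    have hlt : Nat.find hex < n x := by
      by_contra hc
      refine Nat.find_min hex (m := Nat.find hex - n x) (by have := h0 x; omega)
        ⟨(trace E x).2, ?_⟩
      rw [← hout, ← iterate_add_apply, Nat.sub_add_cancel (by omega), hx]
    exact ⟨⟨x, Nat.find hex⟩, by simpa using hlt, hx⟩
  · intros; rfl

/-! ### Closed paths and the loops created by concatenation. -/

/-- The `i`-th inner node, as a node of the bottom box. -/
def loopNode (i : Fin k) : PairNode k := (true, false, i)

theorem inner_loopNode (i : Fin k) : Inner (loopNode i) := by simp [Inner, loopNode]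

theorem loopNode_or_of_inner {v : PairNode k} (h : Inner v) :
    v = loopNode v.2.2 ∨ glue v = loopNode v.2.2 := by
  obtain ⟨b, f, i⟩ := v
  revert h
  cases b <;> cases f <;> simp [Inner, loopNode, glue]

theorem next_fst (v : PairNode k) (h : Inner (next E v)) : (next E v).1 = !v.1 := by
  simp only [Inner, next, glue, along] at h ⊢
  cases hv : v.1 <;> rw [hv] at h <;> simpa [hv] using h.symm

/-- The path of the `i`-th inner node closes up at the `s`-th one after `2 * n` steps for the
first time, and meets only inner nodes whose index is at least `s`. -/
structure ClosesUp (E : Bool → PreDiagram X k) (s i : Fin k) (n : ℕ) : Prop where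
  pos : 0 < n
  inner : ∀ j ≤ 2 * n, 0 < j → Inner ((next E)^[j] (loopNode i))
  le : ∀ j ≤ 2 * n, 0 < j → s ≤ ((next E)^[j] (loopNode i)).2.2
  ne : ∀ j < 2 * n, 0 < j → (next E)^[j] (loopNode i) ≠ loopNode s
  eq : (next E)^[2 * n] (loopNode i) = loopNode s

/-- One round of `loopWalk` is two steps of `next`: an edge of the bottom box, then an edge of the
top box. -/
theorem loopWalk_succ (s : Fin k) (m : ℕ) (i : Fin k) :
    open Classical in
    loopWalk E s (m + 1) i =
      if Inner (next E (loopNode i)) ∧ Inner ((next E)^[2] (loopNode i)) ∧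
        s ≤ (next E (loopNode i)).2.2 ∧ s ≤ ((next E)^[2] (loopNode i)).2.2 then
      if (next E)^[2] (loopNode i) = loopNode s then some (pathWord E 2 (loopNode i))
      else (loopWalk E s m ((next E)^[2] (loopNode i)).2.2).map (pathWord E 2 (loopNode i) ++ ·)
      else none := by
  classical
  rw [loopWalk]
  by_cases h1 : ((E true).mate (north i)).1 = true
  · have : ¬ Inner (next E (loopNode i)) := by simp [Inner, next, glue, along, loopNode, h1]
    simp [h1, this]
  · simp only [Bool.not_eq_true] at h1
    have h2 : next E (loopNode i) = (false, true, ((E true).mate (north i)).2) := by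
      simp [next, glue, along, loopNode, h1]
    have h3 : (next E)^[2] (loopNode i) = glue (along E (next E (loopNode i))) := rfl
    rw [h2] at h3
    simp only [glue, along] at h3
    simp only [h1, h3, h2, pathWord, nodeWord]
    set z := (E false).mate (south ((E true).mate (north i)).2) with hz
    simp only [Inner, loopNode]
    by_cases h5 : z.1 = false
    · simp [h5]
    · simp only [Bool.not_eq_false] at h5
      by_cases h6 : ((E true).mate (north i)).2 < s
      · simp [h6]
      by_cases h7 : z.2 < s
      · simp [h7]
      · simp [h5, h6, h7, not_lt.mp h6, not_lt.mp h7]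

theorem iterate_two_loopNode {i : Fin k} (h1 : Inner (next E (loopNode i)))
    (h2 : Inner ((next E)^[2] (loopNode i))) :
    (next E)^[2] (loopNode i) = loopNode ((next E)^[2] (loopNode i)).2.2 := by
  have h3 := next_fst _ h2
  rw [next_fst _ h1] at h3
  change ((next E)^[2] (loopNode i)).1 = true at h3
  generalize (next E)^[2] (loopNode i) = v at h2 h3
  obtain ⟨b, f, j⟩ := v
  simp only at h3
  subst h3
  simpa [Inner, loopNode] using h2

theorem pathWord_add (m n : ℕ) (v : PairNode k) :
    pathWord E (m + n) v = pathWord E m v ++ pathWord E n ((next E)^[m] v) := by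
  induction n with
  | zero => simp [pathWord]
  | succ n ih =>
    rw [← add_assoc, pathWord_succ, ih, pathWord_succ, ← iterate_add_apply, add_comm n m,
      List.append_assoc]

theorem exists_closesUp (m : ℕ) (s i : Fin k) (w : List X) (h : loopWalk E s m i = some w) :
    ∃ n, ClosesUp E s i n ∧ w = pathWord E (2 * n) (loopNode i) := by
  classical
  induction m generalizing i w with
  | zero => simp [loopWalk] at h
  | succ m ih =>
    rw [loopWalk_succ] at h
    split_ifs at h with h1 h2
    · obtain ⟨h3, h4, h5, h6⟩ := h1
      refine ⟨1, ⟨one_pos, ?_, ?_, ?_, h2⟩, (Option.some.inj h).symm⟩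
      · intro j hj h0
        obtain rfl | rfl : j = 1 ∨ j = 2 := by omega
        exacts [h3, h4]
      · intro j hj h0
        obtain rfl | rfl : j = 1 ∨ j = 2 := by omega
        exacts [h5, h6]
      · intro j hj h0 h7
        -- After one step the path is in the top box, whereas `loopNode s` belongs to the bottom
        -- box.
        obtain rfl : j = 1 := by omega
        have h8 := next_fst _ h3
        rw [show next E (loopNode i) = loopNode s from h7] at h8
        simp [loopNode] at h8
    · obtain ⟨h3, h4, h5, h6⟩ := h1
      obtain ⟨w', hw', rfl⟩ := Option.map_eq_some_iff.1 h
      obtain ⟨n, hn, rfl⟩ := ih _ _ hw'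
      rw [← iterate_two_loopNode h3 h4] at hw' ⊢
      obtain ⟨p1, p2, p3, p4, p5⟩ := hn
      rw [← iterate_two_loopNode h3 h4] at p2 p3 p4 p5
      simp only [← iterate_add_apply] at p2 p3 p4 p5
      refine ⟨n + 1, ⟨by omega, ?_, ?_, ?_, ?_⟩, ?_⟩
      · intro j hj h0
        obtain rfl | rfl | hj' : j = 1 ∨ j = 2 ∨ 2 < j := by omega
        · exact h3
        · exact h4
        · have := p2 (j - 2) (by omega) (by omega)
          rwa [Nat.sub_add_cancel (by omega)] at this
      · intro j hj h0
        obtain rfl | rfl | hj' : j = 1 ∨ j = 2 ∨ 2 < j := by omega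
        · exact h5
        · exact h6
        · have := p3 (j - 2) (by omega) (by omega)
          rwa [Nat.sub_add_cancel (by omega)] at this
      · intro j hj h0 h7
        obtain rfl | rfl | hj' : j = 1 ∨ j = 2 ∨ 2 < j := by omega
        · have h8 := next_fst _ h3
          rw [show next E (loopNode i) = loopNode s from h7] at h8
          simp [loopNode] at h8
        · exact h2 h7
        · have := p4 (j - 2) (by omega) (by omega)
          rw [Nat.sub_add_cancel (by omega)] at this
          exact this h7
      · rw [← p5]; rfl
      · rw [show 2 * (n + 1) = 2 + 2 * n by ring, pathWord_add]

theorem ClosesUp.loopWalk_eq {s i : Fin k} {n : ℕ} (h : ClosesUp E s i n) {m : ℕ} (hm : n ≤ m) :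
    loopWalk E s m i = some (pathWord E (2 * n) (loopNode i)) := by
  classical
  induction m generalizing i n with
  | zero => exact absurd h.pos (by omega)
  | succ m ih =>
    have h0 := h.pos
    have h1 : Inner (next E (loopNode i)) := h.inner 1 (by omega) (by omega)
    have h2 := h.inner 2 (by omega) (by omega)
    rw [loopWalk_succ, if_pos ⟨h1, h2, h.le 1 (by omega) (by omega),
      h.le 2 (by omega) (by omega)⟩]
    split_ifs with h3
    · obtain rfl : n = 1 := by
        by_contra h4
        exact h.ne 2 (by omega) (by omega) h3
      rfl
    · obtain ⟨n, rfl⟩ : ∃ n', n = n' + 1 := ⟨n - 1, by omega⟩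
      have h4 : n ≠ 0 := by
        rintro rfl
        exact h3 h.eq
      have h5 : ClosesUp E s ((next E)^[2] (loopNode i)).2.2 n := by
        constructor <;> try rw [← iterate_two_loopNode h1 h2]
        all_goals try simp only [← iterate_add_apply]
        · omega
        · exact fun j hj h0 => h.inner _ (by omega) (by omega)
        · exact fun j hj h0 => h.le _ (by omega) (by omega)
        · exact fun j hj h0 => h.ne _ (by omega) (by omega)
        · exact h.eq
      rw [ih h5 (by omega), ← iterate_two_loopNode h1 h2, show 2 * (n + 1) = 2 + 2 * n by ring,
        pathWord_add]
      rfl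

theorem iterate_fst {v : PairNode k} (hv : ¬ Through E v) (n : ℕ) :
    ((next E)^[n] v).1 = (!·)^[n] v.1 := by
  induction n with
  | zero => rfl
  | succ n ih =>
    rw [iterate_succ_apply', iterate_succ_apply', ← ih]
    refine next_fst _ (by_contra fun hc => hv ⟨_, ⟨n + 1, ?_⟩, hc⟩)
    rw [iterate_succ_apply']

theorem Reaches.inner {v w : PairNode k} (hv : ¬ Through E v) (h : Reaches E v w) : Inner w :=
  by_contra fun hc => hv ⟨w, h, hc⟩

/-- A closed path is found by `loopWalk` at the smallest index that it meets. -/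
theorem closesUp_of_minimal (hE : ∀ b, (E b).IsMatched) {s : Fin k}
    (hs : ¬ Through E (loopNode s)) (hmin : ∀ w, Reaches E (loopNode s) w → s ≤ w.2.2) :
    ∃ n ≤ k, ClosesUp E s s n ∧ 2 * n = minimalPeriod (next E) (loopNode s) := by
  set p := minimalPeriod (next E) (loopNode s) with hp
  have hp0 : 0 < p := minimalPeriod_pos_of_mem_periodicPts ((next_injective hE).mem_periodicPts _)
  have hper : (next E)^[p] (loopNode s) = loopNode s := iterate_minimalPeriod
  -- Each step on a closed path changes the box.
  have heven : Even p := by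
    by_contra hodd
    rw [Nat.not_even_iff_odd] at hodd
    have h1 := iterate_fst hs p
    rw [hper, Involutive.iterate_odd Bool.not_not hodd] at h1
    simp [loopNode] at h1
  obtain ⟨n, hn⟩ := heven
  rw [← two_mul] at hn
  refine ⟨n, ?_, ⟨by omega, fun j _ _ => Reaches.inner hs ⟨j, rfl⟩, fun j _ _ => hmin _ ⟨j, rfl⟩,
    fun j hj h0 h => ?_, by rw [← hn, hper]⟩, hn.symm⟩
  -- At even times the path is in the bottom box, where the index determines the inner node. So the
  -- `n` nodes met within one period have distinct indices, and fuel `k` suffices.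
  · have hinj : Injective fun j : Fin n => ((next E)^[2 * j.1] (loopNode s)).2.2 := by
      have hnode : ∀ j, (next E)^[2 * j] (loopNode s) =
          loopNode ((next E)^[2 * j] (loopNode s)).2.2 := by
        intro j
        refine (loopNode_or_of_inner (Reaches.inner hs ⟨2 * j, rfl⟩)).resolve_right fun h => ?_
        have h1 := iterate_fst hs (2 * j)
        rw [Involutive.iterate_even Bool.not_not (even_two_mul j)] at h1
        have h2 := Reaches.inner hs ⟨2 * j, rfl⟩
        have h3 := congrArg Prod.fst h
        exact h2 (h3.trans h1.symm)
      intro i j hij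
      have h1 : (next E)^[2 * i.1] (loopNode s) = (next E)^[2 * j.1] (loopNode s) := by
        rw [hnode, hnode j.1]
        exact congrArg loopNode hij
      have h2 := iterate_injOn_Iio_minimalPeriod (f := next E) (x := loopNode s)
        (by simp only [Set.mem_Iio]; omega) (by simp only [Set.mem_Iio]; omega) h1
      exact Fin.ext (by omega)
    simpa using Fintype.card_le_of_injective _ hinj
  · exact not_isPeriodicPt_of_pos_of_lt_minimalPeriod h0.ne' (by omega) h

/-- The `s`-th inner node lies on a closed path that meets no smaller index. -/
def IsLoopBase (E : Bool → PreDiagram X k) (s : Fin k) : Prop :=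
  ¬ Through E (loopNode s) ∧ ∀ w, Reaches E (loopNode s) w → s ≤ w.2.2

theorem ClosesUp.isLoopBase {s : Fin k} {n : ℕ} (h : ClosesUp E s s n) : IsLoopBase E s := by
  have key : ∀ w, Reaches E (loopNode s) w → Inner w ∧ s ≤ w.2.2 := by
    rintro w ⟨j, rfl⟩
    have hper : IsPeriodicPt (next E) (2 * n) (loopNode s) := h.eq
    rw [← hper.iterate_mod_apply]
    rcases Nat.eq_zero_or_pos (j % (2 * n)) with h0 | h0
    · rw [h0]
      exact ⟨inner_loopNode s, le_rfl⟩
    · have := Nat.mod_lt j (show 0 < 2 * n by have := h.pos; omega)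
      exact ⟨h.inner _ this.le h0, h.le _ this.le h0⟩
  exact ⟨fun ⟨w, hw, hw'⟩ => hw' (key w hw).1, fun w hw => (key w hw).2⟩

/-- This replaces the bounded search by orbits: a word is returned precisely at the smallest index
of a closed path, and it is read off over one full period. -/
theorem loopWalk_self (hE : ∀ b, (E b).IsMatched) (s : Fin k) :
    open Classical in
    loopWalk E s k s = if IsLoopBase E s then
      some (pathWord E (minimalPeriod (next E) (loopNode s)) (loopNode s)) else none := by
  classical
  split_ifs with h
  · obtain ⟨n, hn, hc, hp⟩ := closesUp_of_minimal hE h.1 h.2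
    rw [hc.loopWalk_eq hn, hp]
  · cases hw : loopWalk E s k s with
    | none => rfl
    | some w =>
      obtain ⟨n, hn, -⟩ := exists_closesUp _ _ _ _ hw
      exact absurd hn.isLoopBase h

theorem prod_map_filterMap {α β M : Type*} [CommMonoid M] (f : α → Option β) (g : β → M)
    (s : Multiset α) :
    ((s.filterMap f).map g).prod = (s.map fun a => (f a).elim 1 g).prod := by
  induction s using Multiset.induction_on with
  | empty => simp
  | cons a s ih => cases h : f a <;> simp [h, ih]

theorem IsLoopBase.le_of_reaches (hE : ∀ b, (E b).IsMatched) {s t : Fin k} {v : PairNode k}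
    (hs : IsLoopBase E s) (h : Reaches E (loopNode s) v)
    (hv : Reaches E (loopNode t) v ∨ Reaches E (glue (loopNode t)) v) : s ≤ t := by
  rcases hv with hv | hv
  · exact hs.2 _ (h.trans (hv.symm hE))
  · exact hs.2 _ (h.trans (hv.symm hE))

theorem nodeContent_along {M : Type} [CommMonoid M] (g : X → M) (hE : ∀ b, (E b).IsMatched)
    (v : PairNode k) : nodeContent g E (along E v) = nodeContent g E v := by
  rw [nodeContent, nodeWord_along hE, ((List.reverse_perm _).map g).prod_eq, nodeContent]

theorem along_injective (hE : ∀ b, (E b).IsMatched) : Injective (along E) :=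
  (show Involutive (along E) from along_along hE).injective

/-- The new loops, each one run through in both directions, meet exactly once each node from
which no outer node can be reached. -/
theorem prod_newLoops {M : Type} [CommMonoid M] (g : X → M) (hE : ∀ b, (E b).IsMatched) :
    open Classical in
    ((newLoops E).map (LoopWord.content g)).prod ^ 2 =
      ∏ v ∈ Finset.univ.filter (fun v => ¬ Through E v), nodeContent g E v := by
  classical
  have h1 : ((newLoops E).map (LoopWord.content g)).prod =
      ∏ s ∈ Finset.univ.filter (IsLoopBase E),
        ∏ j ∈ Finset.range (minimalPeriod (next E) (loopNode s)),
          nodeContent g E ((next E)^[j] (loopNode s)) := by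
    rw [newLoops, Multiset.map_map, prod_map_filterMap, Finset.prod_filter]
    refine congrArg Multiset.prod (Multiset.map_congr rfl fun s _ => ?_)
    rw [loopWalk_self hE]
    split_ifs
    · exact prod_map_pathWord g _ _
    · rfl
  -- The square is spread over a Boolean that chooses between the two ends of each edge, that is,
  -- between the two directions of the loop.
  have h2 : ((newLoops E).map (LoopWord.content g)).prod ^ 2 =
      ∏ s ∈ Finset.univ.filter (IsLoopBase E),
        ∏ p ∈ Finset.range (minimalPeriod (next E) (loopNode s)) ×ˢ (Finset.univ : Finset Bool),
          nodeContent g E (if p.2 then along E ((next E)^[p.1] (loopNode s))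
            else (next E)^[p.1] (loopNode s)) := by
    rw [h1, ← Finset.prod_pow]
    refine Finset.prod_congr rfl fun s _ => ?_
    rw [Finset.prod_product, ← Finset.prod_pow]
    refine Finset.prod_congr rfl fun j _ => ?_
    simp [nodeContent_along g hE, sq]
  rw [h2, Finset.prod_sigma']
  refine Finset.prod_nbij (fun p => if p.2.2 then along E ((next E)^[p.2.1] (loopNode p.1))
            else (next E)^[p.2.1] (loopNode p.1)) ?_ ?_ ?_ ?_
  · rintro ⟨s, j, e⟩ hp
    simp only [Finset.mem_sigma, Finset.mem_filter, Finset.mem_univ, true_and] at hp ⊢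
    have h3 : ¬ Through E ((next E)^[j] (loopNode s)) :=
      not_through_of_reaches ⟨j, rfl⟩ hp.1.1
    cases e
    · simpa using h3
    · simp only [if_true]
      rintro ⟨w, hw, hw'⟩
      refine h3 ⟨glue w, ?_, by rwa [inner_glue]⟩
      refine (reaches_next _).trans ?_
      simpa [next] using hw.glue hE
  -- A common node forces equal smallest indices, hence equal bases. If the directions differed, the
  -- path would reach the glued image of its own base, contrary to `not_reaches_glue`.
  · have key : ∀ s s' j j' e, IsLoopBase E s → IsLoopBase E s' →
        (next E)^[j] (loopNode s) = (if e then along E ((next E)^[j'] (loopNode s'))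
            else (next E)^[j'] (loopNode s')) → s = s' ∧ e = false := by
      intro s s' j j' e hs hs' h
      cases e
      · simp only [Bool.false_eq_true, if_false] at h
        refine ⟨le_antisymm (hs.le_of_reaches hE ⟨j, rfl⟩ (Or.inl ⟨j', h.symm⟩))
          (hs'.le_of_reaches hE ⟨j', rfl⟩ (Or.inl ⟨j, h⟩)), rfl⟩
      · simp only [if_true] at h
        exfalso
        have h3 : Reaches E (loopNode s) (glue (loopNode s')) := by
          have h4 : Reaches E (loopNode s') (next E ((next E)^[j'] (loopNode s'))) :=
            ⟨j' + 1, iterate_succ_apply' _ _ _⟩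
          refine Reaches.trans ⟨j, h⟩ (Reaches.symm hE ?_)
          exact h4.glue hE
        have h5 := h3.glue hE
        have h6 : s = s' := le_antisymm (hs.2 _ h3)
          (hs'.2 _ (h5.symm hE))
        subst h6
        exact not_reaches_glue hE hs.1 h3
    have key2 : ∀ s j j', j < minimalPeriod (next E) (loopNode s) →
        j' < minimalPeriod (next E) (loopNode s) →
        (next E)^[j] (loopNode s) = (next E)^[j'] (loopNode s) → j = j' :=
      fun s j j' hj hj' h => iterate_injOn_Iio_minimalPeriod hj hj' h
    rintro ⟨s, j, e⟩ hp ⟨s', j', e'⟩ hp' h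
    simp only [Finset.coe_sigma, Set.mem_sigma_iff, Finset.coe_filter, Finset.mem_univ, true_and,
      Set.mem_ofPred_eq, Finset.coe_product, Set.mem_prod, Finset.coe_range, Set.mem_Iio] at hp hp'
    obtain ⟨hs, hj, -⟩ := hp
    obtain ⟨hs', hj', -⟩ := hp'
    cases e
    · obtain ⟨rfl, rfl⟩ := key s s' j j' e' hs hs' (by simpa using h)
      obtain rfl := key2 s j j' hj hj' (by simpa using h)
      rfl
    · cases e'
      · have := (key s' s j' j true hs' hs (by simpa using h.symm)).2
        simp at this
      · simp only [if_true] at h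
        have h' := along_injective hE h
        obtain ⟨rfl, -⟩ := key s s' j j' false hs hs' (by simpa using h')
        obtain rfl := key2 s j j' hj hj' h'
        rfl
  · intro v hv
    simp only [Finset.coe_filter, Finset.mem_univ, true_and, Set.mem_ofPred_eq] at hv
    -- The smallest index reached from `v` gives the base. According to the box in which it is met,
    -- `v` lies on the loop from that base, or the other end of its edge does.
    obtain ⟨u, hu, hmin⟩ := Finset.exists_min_image (Finset.univ.filter (Reaches E v))
      (fun w => w.2.2) ⟨v, by simp [Reaches.refl]⟩
    simp only [Finset.mem_filter, Finset.mem_univ, true_and] at hu hmin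
    have huT := not_through_of_reaches hu hv
    have hui := hu.inner hv
    set s := u.2.2 with hs
    have hfin : ∀ w (e : Bool), Reaches E (loopNode s) w → IsLoopBase E s →
        v = (if e then along E w else w) → v ∈ (fun p : (_ : Fin k) × ℕ × Bool =>
          if p.2.2 then along E ((next E)^[p.2.1] (loopNode p.1))
            else (next E)^[p.2.1] (loopNode p.1)) ''
          ((Finset.univ.filter (IsLoopBase E)).sigma fun s =>
            Finset.range (minimalPeriod (next E) (loopNode s)) ×ˢ (Finset.univ : Finset Bool) :
              Finset ((_ : Fin k) × ℕ × Bool)) := by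
      rintro w e ⟨j, rfl⟩ hb rfl
      refine ⟨⟨s, j % minimalPeriod (next E) (loopNode s), e⟩, ?_, ?_⟩
      · simpa [hb] using Nat.mod_lt _ (minimalPeriod_pos_of_mem_periodicPts
          ((next_injective hE).mem_periodicPts _))
      · simp only [iterate_mod_minimalPeriod_eq]
    rcases loopNode_or_of_inner hui with h | h
    · rw [← hs] at h
      rw [h] at hu huT
      exact hfin v false (hu.symm hE) ⟨huT, fun w hw => hmin w (hu.trans hw)⟩ rfl
    · rw [← hs] at h
      have hmin' : ∀ w, Reaches E (loopNode s) w → Inner w ∧ s ≤ w.2.2 := by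
        intro w hw
        rw [← h] at hw
        have h3 := hu.trans (by simpa using hw.glue hE)
        exact ⟨inner_glue.1 (h3.inner hv), hmin (glue w) h3⟩
      refine hfin (along E v) true ?_ ⟨fun ⟨w, hw, hw'⟩ => hw' (hmin' w hw).1,
        fun w hw => (hmin' w hw).2⟩ (by simp [along_along hE])
      rw [← h]
      exact ((hu.symm hE).trans (reaches_next v)).glue hE
  · intros; rfl

end PairPath

/-- Concatenation neither creates nor removes decorations. -/
theorem PreDiagram.content_concat {X M : Type} {k : ℕ} [CommMonoid M] (g : X → M)
    {t d : PreDiagram X k} (ht : t.IsMatched) (hd : d.IsMatched) :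
    (t.concat d).content g = t.content g * d.content g := by
  classical
  set E : Bool → PreDiagram X k := fun b => if b then d else t with hE'
  have hE : ∀ b, (E b).IsMatched := by rintro (_ | _) <;> assumption
  have h1 : (∏ v, PairPath.nodeContent g E v) =
      (∏ x, ((d.word x).map g).prod) * ∏ x, ((t.word x).map g).prod := by
    rw [Fintype.prod_prod_type, Fintype.prod_bool]
    rfl
  have h2 : (t.concat d).content g = (∏ x, ((trace E x).1.map g).prod) *
      ((t.loops + d.loops + newLoops E).map (LoopWord.content g)).prod ^ 2 := rfl
  rw [h2, Multiset.map_add, Multiset.prod_add, mul_pow, PairPath.prod_trace g hE,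
    PairPath.prod_newLoops g hE, mul_left_comm, Finset.prod_filter_mul_prod_filter_not, h1,
    Multiset.map_add, Multiset.prod_add, mul_pow, content, content]
  ac_rfl

/-! ## Normal forms of words -/

/-- The contents of a non-empty block of decorations of one type: the number of bullets (or of
circles) modulo two.  The empty block is the identity. -/
abbrev BlockParity : Type := WithOne (Multiplicative (ZMod 2))

/-- The parity of the number of bullets or circles of which a decoration is the product. -/
def Omega.parity : Omega → Multiplicative (ZMod 2)
  | .bullet => Multiplicative.ofAdd 1
  | .closedTri => Multiplicative.ofAdd 0
  | .circ => Multiplicative.ofAdd 1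
  | .openTri => Multiplicative.ofAdd 0

theorem Omega.eq_of_parity_eq {c c' : Omega} (h : c.isClosed = c'.isClosed)
    (h' : c.parity = c'.parity) : c = c' := by
  revert h h'
  cases c <;> cases c' <;> decide

/-- A word of decorations up to the block relations and powers of two. -/
noncomputable def wordClass (w : List Omega) : Monoid.CoprodI fun _ : Bool => BlockParity :=
  (w.map fun c => Monoid.CoprodI.of (i := c.isClosed) (c.parity : BlockParity)).prod

/-- A vertical order of decorations up to the block relations and powers of two. -/
noncomputable def orderClass {ι : Type} (o : List (ι × Omega)) :
    Monoid.CoprodI fun _ : ι × Bool => BlockParity :=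
  (o.map fun p => Monoid.CoprodI.of (i := (p.1, p.2.isClosed)) (p.2.parity : BlockParity)).prod

@[simp] theorem wordClass_append (u v : List Omega) :
    wordClass (u ++ v) = wordClass u * wordClass v := by simp [wordClass]

@[simp] theorem orderClass_append {ι : Type} (u v : List (ι × Omega)) :
    orderClass (u ++ v) = orderClass u * orderClass v := by simp [orderClass]

/-- A list whose neighbours have different keys is a reduced word of the free product, and reduced
words are determined by their product. A triangle has parity zero, but it is still not the identity
because the identity of `BlockParity` is adjoined anew. -/
theorem list_eq_of_prod_of_eq {A ι : Type} [DecidableEq ι] (key : A → ι)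
    (par : A → Multiplicative (ZMod 2))
    (hinj : ∀ a a', key a = key a' → par a = par a' → a = a') {l l' : List A}
    (hl : l.IsChain fun a a' => key a ≠ key a') (hl' : l'.IsChain fun a a' => key a ≠ key a')
    (h : (l.map fun a => Monoid.CoprodI.of (M := fun _ : ι => BlockParity) (i := key a)
        (par a : BlockParity)).prod =
      (l'.map fun a => Monoid.CoprodI.of (M := fun _ : ι => BlockParity) (i := key a)
        (par a : BlockParity)).prod) : l = l' := by
  classical
  let f : A → (_ : ι) × BlockParity := fun a => ⟨key a, (par a : BlockParity)⟩
  have hf : Function.Injective f := by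
    intro a a' h
    simp only [f, Sigma.mk.injEq, heq_eq_eq, WithOne.coe_inj] at h
    exact hinj a a' h.1 h.2
  let W : ∀ l : List A, (l.IsChain fun a a' => key a ≠ key a') →
      Monoid.CoprodI.Word fun _ : ι => BlockParity := fun l hl =>
    { toList := l.map f
      ne_one := by
        simp only [List.mem_map, forall_exists_index, and_imp, forall_apply_eq_imp_iff₂]
        exact fun a _ => WithOne.coe_ne_one
      chain_ne := (List.isChain_map f).2 hl }
  have hW : ∀ l hl, (W l hl).prod = (l.map fun a =>
      Monoid.CoprodI.of (M := fun _ : ι => BlockParity) (i := key a)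
        (par a : BlockParity)).prod := by
    intro l hl
    simp only [W, Monoid.CoprodI.Word.prod, List.map_map]
    rfl
  have h1 : W l hl = W l' hl' := by
    apply Monoid.CoprodI.Word.equiv.symm.injective
    change (W l hl).prod = (W l' hl').prod
    rw [hW l hl, hW l' hl', h]
  exact List.map_injective_iff.2 hf (congrArg Monoid.CoprodI.Word.toList h1)

theorem eq_of_wordClass_eq {u v : List Omega} (hu : IsAlternating u) (hv : IsAlternating v)
    (h : wordClass u = wordClass v) : u = v :=
  list_eq_of_prod_of_eq Omega.isClosed Omega.parity (fun _ _ => Omega.eq_of_parity_eq) hu hv h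

/-- The free factors are indexed by edge and type, so two decorations merge only if they are
vertically adjacent on the same edge and of the same type: this is the block structure for `a`-value
`1`. -/
theorem eq_of_orderClass_eq {ι : Type} [DecidableEq ι] {u v : List (ι × Omega)}
    (hu : u.IsChain fun p p' => p.1 = p'.1 → p.2.isClosed ≠ p'.2.isClosed)
    (hv : v.IsChain fun p p' => p.1 = p'.1 → p.2.isClosed ≠ p'.2.isClosed)
    (h : orderClass u = orderClass v) : u = v := by
  refine list_eq_of_prod_of_eq (fun p : ι × Omega => (p.1, p.2.isClosed)) (fun p => p.2.parity)
    ?_ (hu.imp ?_) (hv.imp ?_) h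
  · rintro ⟨i, c⟩ ⟨i', c'⟩ h1 h2
    simp only [Prod.mk.injEq] at h1 h2 ⊢
    exact ⟨h1.1, Omega.eq_of_parity_eq h1.2 h2⟩
  · exact fun p p' h1 h2 => h1 (Prod.mk.inj h2).1 (Prod.mk.inj h2).2
  · exact fun p p' h1 h2 => h1 (Prod.mk.inj h2).1 (Prod.mk.inj h2).2

/-- Relabelling the factors induces a homomorphism of free products. It is applied when the edges of
the bottom diagram are renamed after the north nodes of the product. -/
theorem orderClass_map_index {ι κ : Type} (f : ι → κ) {u v : List (ι × Omega)}
    (h : orderClass u = orderClass v) :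
    orderClass (u.map fun p => (f p.1, p.2)) = orderClass (v.map fun p => (f p.1, p.2)) := by
  have key : ∀ w : List (ι × Omega), orderClass (w.map fun p => (f p.1, p.2)) =
      Monoid.CoprodI.lift (fun b : ι × Bool => Monoid.CoprodI.of
        (M := fun _ : κ × Bool => BlockParity) (i := (f b.1, b.2))) (orderClass w) := by
    intro w
    simp only [orderClass, map_list_prod, List.map_map]
    congr 2
  rw [key, key, h]

theorem orderClass_map_mk {ι : Type} (i : ι) {u v : List Omega} (h : wordClass u = wordClass v) :
    orderClass (u.map fun c => (i, c)) = orderClass (v.map fun c => (i, c)) := by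
  have key : ∀ w : List Omega, orderClass (w.map fun c => (i, c)) =
      Monoid.CoprodI.lift (fun b : Bool => Monoid.CoprodI.of
        (M := fun _ : ι × Bool => BlockParity) (i := (i, b))) (wordClass w) := by
    intro w
    simp only [orderClass, wordClass, map_list_prod, List.map_map]
    congr 2
  rw [key, key, h]

theorem orderClass_flatMap {A ι : Type} (l : List A) (f : A → List (ι × Omega)) :
    orderClass (l.flatMap f) = (l.map fun a => orderClass (f a)).prod := by
  induction l with
  | nil => rfl
  | cons a l ih => simp [ih]

/-- The contents of a decoration, separately for closed and open ones. -/
def Omega.parities (c : Omega) : BlockParity × BlockParity :=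
  if c.isClosed then (c.parity, 1) else (1, c.parity)

/-- The free product maps to the direct product of its two factors. This commutative image is what
survives on a loop, where words are only known up to rotation and reversal. -/
theorem prod_parities_eq {u v : List Omega} (h : wordClass u = wordClass v) :
    (u.map Omega.parities).prod = (v.map Omega.parities).prod := by
  have key : ∀ w : List Omega, (w.map Omega.parities).prod =
      Monoid.CoprodI.lift (fun b : Bool => if b then MonoidHom.inl BlockParity BlockParity
        else MonoidHom.inr BlockParity BlockParity) (wordClass w) := by
    intro w
    simp only [wordClass, map_list_prod, List.map_map]
    congr 2
    funext c
    cases c <;> simp [Omega.parities, Omega.isClosed]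
  rw [key, key, h]

theorem BlockRel.wordClass_eq {u v : List Omega} {m : ℤ} (h : BlockRel u m v) :
    wordClass u = wordClass v := by
  cases h <;> simp only [wordClass, List.map_cons, List.map_nil, List.prod_cons, List.prod_nil,
    mul_one, ← map_mul, Omega.isClosed, Omega.parity, ← WithOne.coe_mul] <;> rfl

/-- The set of relations is stable under reversal, as needed at the far end of an edge. -/
theorem BlockRel.wordClass_reverse_eq {u v : List Omega} {m : ℤ} (h : BlockRel u m v) :
    wordClass u.reverse = wordClass v.reverse := by
  cases h
  · exact BlockRel.closed_two.wordClass_eq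
  · exact BlockRel.closed_three'.wordClass_eq
  · exact BlockRel.closed_three.wordClass_eq
  · exact BlockRel.open_two.wordClass_eq
  · exact BlockRel.open_three'.wordClass_eq
  · exact BlockRel.open_three.wordClass_eq

/-! ## The shape of a diagram -/

/-- The contents of a loop that is replaced by a scalar. -/
def IsScalarContent (p : BlockParity × BlockParity) : Prop :=
  p = 1 ∨ p = Omega.parities .closedTri ∨ p = Omega.parities .openTri

open Classical in
/-- What the relations leave of a diagram, up to scalars. -/
noncomputable def PreDiagram.shape {k : ℕ} (d : PreDiagram Omega k) :
    (BoxNode k → BoxNode k) × (BoxNode k → Monoid.CoprodI fun _ : Bool => BlockParity) ×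
      (Monoid.CoprodI fun _ : Fin k × Bool => BlockParity) × Multiset (BlockParity × BlockParity) :=
  (d.mate, fun x => wordClass (d.word x), orderClass d.order,
    (d.loops.map (LoopWord.content Omega.parities)).filter fun p => ¬ IsScalarContent p)

/-! ### Concatenation respects shapes. -/

/-- Two pairs of boxes that agree up to the block relations on the edges. -/
structure PairCongr {k : ℕ} (E E' : Bool → PreDiagram Omega k) : Prop where
  mate : ∀ b, (E b).mate = (E' b).mate
  word : ∀ b x, wordClass ((E b).word x) = wordClass ((E' b).word x)

namespace PairCongr

open PreDiagram

variable {k : ℕ} {E E' : Bool → PreDiagram Omega k}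

theorem walk (h : PairCongr E E') (m : ℕ) (b : Bool) (i : Fin k) :
    wordClass (walk E m b i).1 = wordClass (PreDiagram.walk E' m b i).1 ∧
      (PreDiagram.walk E m b i).2 = (PreDiagram.walk E' m b i).2 := by
  induction m generalizing b i with
  | zero => exact ⟨rfl, rfl⟩
  | succ m ih =>
    simp only [PreDiagram.walk, h.mate]
    split_ifs
    · exact ⟨h.word _ _, rfl⟩
    · simp only [wordClass_append, h.word, (ih _ _).1, (ih _ _).2, and_self]

theorem trace (h : PairCongr E E') (x : BoxNode k) :
    wordClass (trace E x).1 = wordClass (PreDiagram.trace E' x).1 ∧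
      (PreDiagram.trace E x).2 = (PreDiagram.trace E' x).2 := by
  simp only [PreDiagram.trace, h.mate]
  split_ifs
  · exact ⟨h.word _ _, rfl⟩
  · simp only [wordClass_append, h.word, (h.walk _ _ _).1, (h.walk _ _ _).2, and_self]

/-- Whether and where a path closes up depends on the matchings alone; the words enter only
multiplicatively. -/
theorem loopWalk (h : PairCongr E E') (s : Fin k) (m : ℕ) (i : Fin k) :
    (loopWalk E s m i).map wordClass = (PreDiagram.loopWalk E' s m i).map wordClass := by
  induction m generalizing i with
  | zero => rfl
  | succ m ih =>
    simp only [PreDiagram.loopWalk, h.mate]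
    split_ifs with h1 h2
    · rfl
    · simp [h.word]
    · have key : ∀ (w : List Omega) (o : Option (List Omega)),
          (o.map (w ++ ·)).map wordClass = (o.map wordClass).map (wordClass w * ·) := by
        intro w o
        cases o <;> simp
      rw [key, key, ih]
      simp [h.word]

theorem newLoops (h : PairCongr E E') :
    (newLoops E).map (LoopWord.content Omega.parities) =
      (PreDiagram.newLoops E').map (LoopWord.content Omega.parities) := by
  simp only [PreDiagram.newLoops, Multiset.map_filterMap]
  congr 1
  funext s
  have h1 := h.loopWalk s k s
  cases h2 : PreDiagram.loopWalk E s k s <;> cases h3 : PreDiagram.loopWalk E' s k s <;>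
    simp only [h2, h3, Option.map_none, Option.map_some, Option.some.injEq, reduceCtorEq] at h1 ⊢
  exact prod_parities_eq h1

theorem strip (h : PairCongr E E') :
    PairCongr (fun b => (E b).stripPropagating) fun b => (E' b).stripPropagating where
  mate := h.mate
  word b x := by
    simp only [stripPropagating, h.mate]
    split_ifs
    exacts [h.word b x, rfl]

theorem concatOrder (h : PairCongr E E')
    (ho : ∀ b, orderClass (E b).order = orderClass (E' b).order) :
    orderClass (concatOrder E) = orderClass (PreDiagram.concatOrder E') := by
  simp only [PreDiagram.concatOrder, orderClass_append, ho, orderClass_flatMap]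
  congr 1
  · congr 2
    refine List.map_congr_left fun i _ => ?_
    rw [(h.trace _).2]
    split_ifs
    · exact orderClass_map_mk i (h.strip.trace _).1
    · rfl
  · simp only [(h.walk _ _ _).2]
    exact orderClass_map_index (fun i => (PreDiagram.walk E' k false i).2.2) (ho true)

end PairCongr

theorem PreDiagram.aValue_congr {X Y : Type} {k : ℕ} {d : PreDiagram X k} {d' : PreDiagram Y k}
    (h : d.mate = d'.mate) : d.aValue = d'.aValue := by
  simp only [aValue, h]

/-- The shape of a product is determined by the shapes of the factors. -/
theorem PreDiagram.shape_concat_congr {k : ℕ} {t t' d d' : PreDiagram Omega k}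
    (ht : t.shape = t'.shape) (hd : d.shape = d'.shape) :
    (t.concat d).shape = (t'.concat d').shape ∧
      (newLoops fun b => if b then d else t).map (LoopWord.content Omega.parities) =
        (newLoops fun b => if b then d' else t').map (LoopWord.content Omega.parities) := by
  simp only [shape, Prod.mk.injEq, funext_iff] at ht hd
  obtain ⟨ht1, ht2, ht3, ht4⟩ := ht
  obtain ⟨hd1, hd2, hd3, hd4⟩ := hd
  have hE : PairCongr (fun b => if b then d else t) (fun b => if b then d' else t') := by
    constructor <;> rintro (_ | _)
    exacts [funext ht1, funext hd1, ht2, hd2]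
  have hmate : (t.concat d).mate = (t'.concat d').mate := funext fun x => (hE.trace x).2
  -- The contents of all new loops agree, not only of those kept in the shape; the removable ones
  -- enter the scalar of the product.
  refine ⟨?_, hE.newLoops⟩
  simp only [shape, Prod.mk.injEq]
  refine ⟨hmate, funext fun x => (hE.trace x).1, ?_, ?_⟩
  · have h1 : ∀ t d : PreDiagram Omega k, (t.concat d).order =
        if (t.concat d).aValue = 1 then concatOrder (fun b => if b then d else t) else [] :=
      fun _ _ => rfl
    rw [h1, h1, aValue_congr hmate]
    split_ifs
    · exact hE.concatOrder (by rintro (_ | _); exacts [ht3, hd3])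
    · rfl
  · have h1 : ∀ t d : PreDiagram Omega k, (t.concat d).loops =
        t.loops + d.loops + newLoops (fun b => if b then d else t) := fun _ _ => rfl
    simp only [h1, Multiset.map_add, Multiset.filter_add, ht4, hd4, hE.newLoops]

/-! ## Scalars -/

section Scalar

open Polynomial

variable {A : Type} [Field A] [Algebra ℤ[X] A] {k : ℕ}

/-- The weights of the decorations; `κ` is a fourth root of two. -/
def Omega.weight (κ : A) : Omega → A
  | .bullet => κ
  | .closedTri => κ ^ 2
  | .circ => κ
  | .openTri => κ ^ 2

open Classical in
/-- The scalar that replaces a loop with the given contents, divided by its weight. -/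
noncomputable def loopFactor (A : Type) [Field A] [Algebra ℤ[X] A]
    (p : BlockParity × BlockParity) : A :=
  if p = 1 then algebraMap ℤ[X] A X
  else if IsScalarContent p then algebraMap ℤ[X] A X / 2 else 1

/-- The scalar of a diagram. -/
noncomputable def PreDiagram.scalar (κ : A) (d : PreDiagram Omega k) : A :=
  d.content (Omega.weight κ) *
    ((d.loops.map (LoopWord.content Omega.parities)).map (loopFactor A)).prod

/-- The weights multiply by `content_concat`, so only the factors of the new loops appear as a
correction. They depend on the shapes of `t` and `d` alone. -/
theorem PreDiagram.scalar_concat (κ : A) {t d : PreDiagram Omega k} (ht : t.IsMatched)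
    (hd : d.IsMatched) :
    (t.concat d).scalar κ = t.scalar κ * d.scalar κ *
      (((newLoops fun b => if b then d else t).map (LoopWord.content Omega.parities)).map
        (loopFactor A)).prod := by
  have h1 : (t.concat d).loops = t.loops + d.loops + newLoops (fun b => if b then d else t) := rfl
  simp only [scalar, content_concat _ ht hd, h1, Multiset.map_add, Multiset.prod_add]
  ring

/-- `d` and `c d'` have the same image under the map that sends a diagram to its shape, multiplied
by its scalar. -/
structure PreDiagram.Congr (κ : A) (d : PreDiagram Omega k) (c : ℤ[X])
    (d' : PreDiagram Omega k) : Prop where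
  left : d.IsMatched
  right : d'.IsMatched
  shape : d.shape = d'.shape
  scalar : d.scalar κ = algebraMap ℤ[X] A c * d'.scalar κ

theorem PreDiagram.Congr.mul_left {κ : A} {c : ℤ[X]} {t d d' : PreDiagram Omega k}
    (h : d.Congr κ c d') (ht : t.IsMatched) : (t * d).Congr κ c (t * d') where
  left := ht.concat h.left
  right := ht.concat h.right
  shape := (shape_concat_congr rfl h.shape).1
  scalar := by
    change (t.concat d).scalar κ = _ * (t.concat d').scalar κ
    rw [scalar_concat κ ht h.left, scalar_concat κ ht h.right, h.scalar,
      (shape_concat_congr rfl h.shape).2]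
    ring

theorem PreDiagram.Congr.mul_right {κ : A} {c : ℤ[X]} {t d d' : PreDiagram Omega k}
    (h : d.Congr κ c d') (ht : t.IsMatched) : (d * t).Congr κ c (d' * t) where
  left := h.left.concat ht
  right := h.right.concat ht
  shape := (shape_concat_congr h.shape rfl).1
  scalar := by
    change (d.concat t).scalar κ = _ * (d'.concat t).scalar κ
    rw [scalar_concat κ h.left ht, scalar_concat κ h.right ht, h.scalar,
      (shape_concat_congr h.shape rfl).2]
    ring

/-! ### A submodule stable under multiplication that contains the ideal. -/

/-- The span of the differences of congruent diagrams. -/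
noncomputable def congrSpan (κ : A) (k : ℕ) : Submodule ℤ[X] (DiagramModule k) :=
  Submodule.span ℤ[X]
    {x | ∃ d c d', PreDiagram.Congr κ d c d' ∧ x = ofDiagram d - c • ofDiagram d'}

theorem ofDiagram_mul (t d : PreDiagram Omega k) :
    ofDiagram t * ofDiagram d = ofDiagram (t * d) := by
  simp [ofDiagram, MonoidAlgebra.single_mul_single]

theorem mul_mem_congrSpan {κ : A} {x y : DiagramModule k} (hx : x ∈ congrSpan κ k)
    (hy : y ∈ lrSpan k) : y * x ∈ congrSpan κ k ∧ x * y ∈ congrSpan κ k := by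
  induction hy using Submodule.span_induction with
  | zero => simp
  | add y z _ _ hy hz =>
    rw [add_mul, mul_add]
    exact ⟨add_mem hy.1 hz.1, add_mem hy.2 hz.2⟩
  | smul c y _ hy =>
    rw [smul_mul_assoc, mul_smul_comm]
    exact ⟨Submodule.smul_mem _ _ hy.1, Submodule.smul_mem _ _ hy.2⟩
  | mem y hy =>
    obtain ⟨t, ht, rfl⟩ := hy
    have ht' : t.IsMatched := (IsLR.toIsDiagram ht).isMatched
    induction hx using Submodule.span_induction with
    | zero => simp
    | add x z _ _ hx hz =>
      rw [add_mul, mul_add]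
      exact ⟨add_mem hx.1 hz.1, add_mem hx.2 hz.2⟩
    | smul c x _ hx =>
      rw [smul_mul_assoc, mul_smul_comm]
      exact ⟨Submodule.smul_mem _ _ hx.1, Submodule.smul_mem _ _ hx.2⟩
    | mem x hx =>
      obtain ⟨d, c, d', h, rfl⟩ := hx
      rw [mul_sub, sub_mul, mul_smul_comm, smul_mul_assoc]
      simp only [ofDiagram_mul]
      exact ⟨Submodule.subset_span ⟨_, _, _, h.mul_left ht', rfl⟩,
        Submodule.subset_span ⟨_, _, _, h.mul_right ht', rfl⟩⟩

end Scalar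

/-! ## The local relations preserve shapes -/

section Relations

open Polynomial

variable {A : Type} [Field A] [Algebra ℤ[X] A] {k : ℕ}

/-- The squares are due to the two ends of an edge: they give `√2` for `•` and `∘` and `2` for the
triangles, so that `√2 · √2 = 2` and `√2 · 2 = 2 · √2` match the relations. -/
theorem BlockRel.weight_eq {κ : A} (hκ : κ ^ 4 = 2) {u v : List Omega} {m : ℤ}
    (h : BlockRel u m v) :
    (u.map (Omega.weight κ)).prod ^ 2 =
      algebraMap ℤ[X] A (C m) * (v.map (Omega.weight κ)).prod ^ 2 := by
  cases h <;> simp [Omega.weight, map_ofNat] <;>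
    first | ring1 | linear_combination κ ^ 2 * hκ

theorem PreDiagram.Congr.of_word {κ : A} (hκ : κ ^ 4 = 2) {d d' : PreDiagram Omega k}
    (hd : d.IsMatched) (hd' : d'.IsMatched) (x : BoxNode k) {p u q v : List Omega} {m : ℤ}
    (hrel : BlockRel u m v) (hmate : d'.mate = d.mate) (hloops : d'.loops = d.loops)
    (hword : d.word x = p ++ u ++ q) (hword' : d'.word x = p ++ v ++ q)
    (hother : ∀ y, y ≠ x → y ≠ d.mate x → d'.word y = d.word y)
    (horder : orderClass d.order = orderClass d'.order) : d.Congr κ (C m) d' where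
  left := hd
  right := hd'
  shape := by
    simp only [PreDiagram.shape, Prod.mk.injEq, hmate, hloops, horder, true_and, and_true]
    funext y
    by_cases h1 : y = x
    · subst h1
      simp only [hword, hword', wordClass_append, hrel.wordClass_eq]
    by_cases h2 : y = d.mate x
    · have h3 := hd'.word_mate x
      rw [hmate] at h3
      rw [h2, h3, hd.word_mate, hword, hword']
      simp only [List.reverse_append, wordClass_append, hrel.wordClass_reverse_eq]
    · rw [hother y h1 h2]
  scalar := by
    have hne : d.mate x ∈ Finset.univ.erase x := Finset.mem_erase.2 ⟨hd.mate_ne x, Finset.mem_univ _⟩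
    have key : ∀ e : PreDiagram Omega k, e.IsMatched → e.mate = d.mate →
        ∏ y, ((e.word y).map (Omega.weight κ)).prod =
          ((e.word x).map (Omega.weight κ)).prod ^ 2 *
            ∏ y ∈ (Finset.univ.erase x).erase (d.mate x),
              ((e.word y).map (Omega.weight κ)).prod := by
      intro e he hm
      rw [← Finset.mul_prod_erase _ _ (Finset.mem_univ x), ← Finset.mul_prod_erase _ _ hne, ← hm,
        he.word_mate, ((List.reverse_perm _).map _).prod_eq, ← mul_assoc, sq]
    have hrest : ∏ y ∈ (Finset.univ.erase x).erase (d.mate x),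
          ((d'.word y).map (Omega.weight κ)).prod =
        ∏ y ∈ (Finset.univ.erase x).erase (d.mate x),
          ((d.word y).map (Omega.weight κ)).prod := by
      refine Finset.prod_congr rfl fun y hy => ?_
      simp only [Finset.mem_erase, Finset.mem_univ, and_true] at hy
      rw [hother y hy.2 hy.1]
    simp only [PreDiagram.scalar, content, hloops]
    rw [key d hd rfl, key d' hd' hmate, hrest, hword, hword']
    simp only [List.map_append, List.prod_append, mul_pow, hrel.weight_eq hκ]
    ring

theorem PreDiagram.Congr.of_diagramRel {κ : A} (hκ : κ ^ 4 = 2) (h2 : (2 : A) ≠ 0)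
    {d d' : PreDiagram Omega k} {c : ℤ[X]}
    (hd : d.IsDiagram) (hd' : d'.IsDiagram) (h : DiagramRel d c d') : d.Congr κ c d' := by
  cases h with
  | edge _ x p u q v m hrel hx hmate horder hloops hword hword' hmateword hother =>
    exact .of_word hκ hd.isMatched hd'.isMatched x hrel hmate hloops hword hword' hother
      (by rw [horder])
  | block _ i p q u v m hrel ha hmate hloops horder horder' hother =>
    have ha' : d'.aValue = 1 := by rw [aValue_congr hmate, ha]
    -- The left side of a block relation is non-empty, so the vertical order has a letter on the
    -- edge at `i`.
    have hprop : d.IsPropagating (north i) := by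
      obtain ⟨c, hc⟩ : ∃ c, c ∈ u := by cases hrel <;> exact ⟨_, List.mem_cons_self⟩
      exact hd.order_isPropagating (i, c) (by simp [horder, hc])
    have hprop' : ∀ x, d'.IsPropagating x ↔ d.IsPropagating x := by
      simp [IsPropagating, hmate]
    have hfilter : ∀ (w : List Omega) (j : Fin k),
        ((w.map fun c => (i, c)).filter fun p => p.1 = j).map Prod.snd =
          if i = j then w else [] := by
      intro w j
      split_ifs with hij <;> simp [List.filter_map, Function.comp_def, hij]
    have hnorth : ∀ j, d.IsPropagating (north j) → j ≠ i →
        d'.word (north j) = d.word (north j) := by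
      intro j hj hji
      rw [hd.word_eq_order ha j hj, hd'.word_eq_order ha' j ((hprop' _).2 hj), horder, horder']
      simp only [List.filter_append, List.map_append, hfilter, if_neg hji.symm]
    -- Filtering the vertical order turns the rewriting into one inside the word at the north node
    -- `i`; on the other edges nothing changes.
    refine .of_word hκ hd.isMatched hd'.isMatched (north i) hrel hmate hloops
      (p := (p.filter fun p => p.1 = i).map Prod.snd)
      (q := (q.filter fun p => p.1 = i).map Prod.snd) ?_ ?_ ?_ ?_
    · rw [hd.word_eq_order ha i hprop, horder]
      simp only [List.filter_append, List.map_append, hfilter, if_true]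
    · rw [hd'.word_eq_order ha' i ((hprop' _).2 hprop), horder']
      simp only [List.filter_append, List.map_append, hfilter, if_true]
    · intro y h1 h2
      by_cases hy : d.IsPropagating y
      · obtain ⟨b, j⟩ := y
        cases b
        · exact hnorth j hy fun h => h1 (by rw [h])
        · have h3 : d.mate (south j) = north (d.mate (south j)).2 := by
            simp only [IsPropagating, ne_eq, Bool.not_eq_true] at hy
            exact Prod.ext hy rfl
          have h4 : d.IsPropagating (north (d.mate (south j)).2) := by
            rw [← h3, IsPropagating, hd.mate_mate]
            exact fun h => hy h.symm
          have h5 := hnorth _ h4 (fun h => h2 (by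
            rw [h] at h3
            rw [← h3, hd.mate_mate]))
          rw [← h3] at h5
          have h6 := hd.word_mate (d.mate (south j))
          have h7 := hd'.word_mate (d.mate (south j))
          rw [hd.mate_mate] at h6
          rw [hmate, hd.mate_mate, h5] at h7
          exact h7.trans h6.symm
      · exact hother y hy
    · simp only [horder, horder', orderClass_append, orderClass_map_mk i hrel.wordClass_eq]
  | loop _ p u v L m hrel hmate horder hword hloops hloops' =>
    have hcont : (LoopWord.mk (p ++ u)).content Omega.parities =
        (LoopWord.mk (p ++ v)).content Omega.parities := by
      simp only [LoopWord.content_mk]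
      exact prod_parities_eq (by simp [hrel.wordClass_eq])
    refine ⟨hd.isMatched, hd'.isMatched, ?_, ?_⟩
    · simp only [PreDiagram.shape, hmate, horder, hword, hloops, hloops', Multiset.map_cons, hcont]
    · simp only [PreDiagram.scalar, content, hword, hloops, hloops', Multiset.map_cons, Multiset.prod_cons,
        hcont]
      simp only [LoopWord.content_mk, List.map_append, List.prod_append, mul_pow,
        hrel.weight_eq hκ]
      ring
  | removal _ w hw hmate horder hword hloops =>
    refine ⟨hd.isMatched, hd'.isMatched, ?_, ?_⟩
    · have h1 : IsScalarContent ((LoopWord.mk w).content Omega.parities) := by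
        cases hw <;> simp [IsScalarContent]
      simp only [PreDiagram.shape, hmate, horder, hword, hloops, Multiset.map_cons, Prod.mk.injEq, true_and]
      classical exact Multiset.filter_cons_of_neg _ (not_not.2 h1)
    · have h1 : (LoopWord.mk w).content (Omega.weight κ) ^ 2 *
          loopFactor A ((LoopWord.mk w).content Omega.parities) = algebraMap ℤ[X] A X := by
        cases hw
        · simp [loopFactor]
        · have h3 : Omega.parities .closedTri ≠ 1 := by
            simp [Omega.parities, Omega.isClosed, Prod.ext_iff]
          have h4 : ∀ {M : Type} [CommMonoid M] (g : Omega → M),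
              (LoopWord.mk [Omega.closedTri]).content g = g .closedTri := by simp
          rw [h4, h4, loopFactor, if_neg h3, if_pos (show IsScalarContent _ from Or.inr (Or.inl rfl)), Omega.weight, ← pow_mul, hκ]
          field_simp
        · have h3 : Omega.parities .openTri ≠ 1 := by
            simp [Omega.parities, Omega.isClosed, Prod.ext_iff]
          have h4 : ∀ {M : Type} [CommMonoid M] (g : Omega → M),
              (LoopWord.mk [Omega.openTri]).content g = g .openTri := by simp
          rw [h4, h4, loopFactor, if_neg h3, if_pos (show IsScalarContent _ from Or.inr (Or.inr rfl)), Omega.weight, ← pow_mul, hκ]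
          field_simp
      simp only [PreDiagram.scalar, content, hword, hloops, Multiset.map_cons, Multiset.prod_cons, ← h1]
      ring

/-- `congrSpan` is one of the submodules whose intersection defines the ideal. -/
theorem relationIdeal_le_congrSpan {κ : A} (hκ : κ ^ 4 = 2) (h2 : (2 : A) ≠ 0) (k : ℕ) :
    relationIdeal k ≤ congrSpan κ k :=
  sInf_le ⟨fun d c d' hd hd' h =>
    Submodule.subset_span ⟨d, c, d', .of_diagramRel hκ h2 hd.toIsDiagram hd'.toIsDiagram h, rfl⟩,
    fun _ hx _ hy => mul_mem_congrSpan hx hy⟩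

end Relations

/-! ## Basis diagrams are linearly independent -/

section Independence

open Polynomial

variable {A : Type} [Field A] [Algebra ℤ[X] A] {k : ℕ}

/-- The words of the loops that may occur in a basis diagram. -/
def basisLoopWords : List (List Omega) :=
  [[.bullet], [.circ], [.bullet, .circ], [.bullet, .openTri], [.closedTri, .circ],
    [.closedTri, .openTri]]

instance : DecidableEq BlockParity :=
  inferInstanceAs (DecidableEq (Option (Multiplicative (ZMod 2))))

theorem prod_parities_injOn : ∀ w ∈ basisLoopWords, ∀ w' ∈ basisLoopWords,
    (w.map Omega.parities).prod = (w'.map Omega.parities).prod → w = w' := by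
  decide

theorem not_isScalarContent : ∀ w ∈ basisLoopWords,
    ¬ IsScalarContent (w.map Omega.parities).prod := by
  unfold IsScalarContent
  decide

theorem length_le_one_of_isAlternating {w : List Omega} {b : Bool} (hw : IsAlternating w)
    (hb : ∀ c ∈ w, c.isClosed = b) : w.length ≤ 1 := by
  match w with
  | [] => simp
  | [_] => simp
  | c :: c' :: w =>
    refine absurd ?_ (List.isChain_cons_cons.1 hw).1
    rw [hb c (by simp), hb c' (by simp)]

/-- The sorted form of a loop is a closed word followed by an open one, and alternation leaves at
most one letter in each. Without the three scalar loops, six words remain, and the parity contents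
tell these apart. -/
theorem IsBasisDiagram.exists_loop_eq {d : PreDiagram Omega k} (hd : IsBasisDiagram d)
    {l : LoopWord Omega} (hl : l ∈ d.loops) : ∃ w ∈ basisLoopWords, l = LoopWord.mk w := by
  obtain ⟨u, v, rfl, hu, hv, -⟩ := hd.loop_sorted l hl
  refine ⟨u ++ v, ?_, rfl⟩
  have h1 := hd.loop_alternating _ hl
  have h2 := hd.not_scalarLoop _ hl
  have hu1 := length_le_one_of_isAlternating (List.isChain_append.1 h1).1 hu
  have hv1 := length_le_one_of_isAlternating (List.isChain_append.1 h1).2.1 hv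
  have h3 : [] ≠ u ++ v := fun h => h2 (h ▸ .plain)
  have h4 : [.closedTri] ≠ u ++ v := fun h => h2 (h ▸ .closedTri)
  have h5 : [.openTri] ≠ u ++ v := fun h => h2 (h ▸ .openTri)
  clear h1 h2 hl
  match u, v with
  | [], [] => exact absurd rfl h3
  | [], [o] => revert hv h5; cases o <;> simp [basisLoopWords, Omega.isClosed]
  | [c], [] => revert hu h4; cases c <;> simp [basisLoopWords, Omega.isClosed]
  | [c], [o] =>
    revert hu hv
    cases c <;> cases o <;> simp [basisLoopWords, Omega.isClosed]
  | _ :: _ :: _, _ => simp at hu1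
  | _, _ :: _ :: _ => simp at hv1

theorem multiset_eq_of_map_eq {α β : Type*} (f : α → β) {s t : Multiset α}
    (hinj : ∀ a ∈ s, ∀ b ∈ t, f a = f b → a = b) (h : s.map f = t.map f) : s = t := by
  rw [← Multiset.rel_eq, Multiset.rel_map] at h
  exact Multiset.rel_eq.1 (h.mono hinj)

theorem isSingleBlock_congr {d d' : PreDiagram Omega k} (h : d.mate = d'.mate) (x : BoxNode k) :
    IsSingleBlock d x ↔ IsSingleBlock d' x := by
  rw [IsSingleBlock, IsSingleBlock, PreDiagram.aValue_congr h, PreDiagram.IsPropagating,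
    PreDiagram.IsPropagating, h]

theorem eq_of_shape_eq {d d' : PreDiagram Omega k} (hd : IsBasisDiagram d)
    (hd' : IsBasisDiagram d') (h : d.shape = d'.shape) : d = d' := by
  simp only [PreDiagram.shape, Prod.mk.injEq, funext_iff] at h
  obtain ⟨h1, h2, h3, h4⟩ := h
  have hmate : d.mate = d'.mate := funext h1
  have horder : d.order = d'.order :=
    eq_of_orderClass_eq hd.block_alternating hd'.block_alternating h3
  have hloops : d.loops = d'.loops := by
    have hall : ∀ e : PreDiagram Omega k, IsBasisDiagram e →
        ∀ p ∈ e.loops.map (LoopWord.content Omega.parities), ¬ IsScalarContent p := by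
      intro e he p hp
      obtain ⟨l, hl, rfl⟩ := Multiset.mem_map.1 hp
      obtain ⟨w, hw, rfl⟩ := he.exists_loop_eq hl
      exact not_isScalarContent w hw
    classical
    rw [Multiset.filter_eq_self.2 (hall d hd), Multiset.filter_eq_self.2 (hall d' hd')] at h4
    refine multiset_eq_of_map_eq _ (fun l hl l' hl' hll => ?_) h4
    obtain ⟨w, hw, rfl⟩ := hd.exists_loop_eq hl
    obtain ⟨w', hw', rfl⟩ := hd'.exists_loop_eq hl'
    rw [prod_parities_injOn w hw w' hw' hll]
  -- For `a`-value `1` the word on a propagating edge need not alternate, because its blocks are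
  -- separated by decorations of other edges. It is recovered from the vertical order instead.
  have hnorth : ∀ i, d.aValue = 1 → d.IsPropagating (north i) →
      d.word (north i) = d'.word (north i) := by
    intro i ha hp
    rw [hd.word_eq_order ha i hp, hd'.word_eq_order (PreDiagram.aValue_congr hmate ▸ ha) i
      (by rwa [PreDiagram.IsPropagating, ← hmate]), horder]
  have hword : d.word = d'.word := by
    funext x
    by_cases hx : IsSingleBlock d x
    · exact eq_of_wordClass_eq (hd.edge_alternating x hx)
        (hd'.edge_alternating x ((isSingleBlock_congr hmate x).1 hx)) (h2 x)
    · simp only [IsSingleBlock, Classical.not_imp, not_not] at hx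
      obtain ⟨b, i⟩ := x
      cases b
      · exact hnorth i hx.1 hx.2
      · have h5 : d.mate (south i) = north (d.mate (south i)).2 := by
          have := hx.2
          simp only [PreDiagram.IsPropagating, ne_eq, Bool.not_eq_true] at this
          exact Prod.ext this rfl
        have h6 : d.IsPropagating (north (d.mate (south i)).2) := by
          rw [← h5, PreDiagram.IsPropagating, hd.mate_mate]
          exact fun h => hx.2 h.symm
        have h7 := hnorth _ hx.1 h6
        rw [← h5] at h7
        have h8 := hd.word_mate (d.mate (south i))
        have h9 := hd'.word_mate (d.mate (south i))
        rw [hd.mate_mate, h7] at h8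
        rw [← hmate, hd.mate_mate] at h9
        exact h8.trans h9.symm
  cases d
  cases d'
  simp_all

theorem PreDiagram.scalar_ne_zero {κ : A} (hκ : κ ^ 4 = 2) (h2 : (2 : A) ≠ 0)
    (hX : algebraMap ℤ[X] A X ≠ 0) (d : PreDiagram Omega k) : d.scalar κ ≠ 0 := by
  have hκ0 : κ ≠ 0 := by
    rintro rfl
    exact h2 (by rw [← hκ]; simp)
  have hw : ∀ c, Omega.weight κ c ≠ 0 := by
    rintro (_ | _) <;> simp [Omega.weight, hκ0]
  have hlist : ∀ w : List Omega, (w.map (Omega.weight κ)).prod ≠ 0 := by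
    intro w
    simp [List.prod_eq_zero_iff, hw]
  have hloop : ∀ l : LoopWord Omega, l.content (Omega.weight κ) ≠ 0 := by
    intro l
    induction l using Quotient.inductionOn with
    | h w => exact hlist w
  have hfac : ∀ p, loopFactor A p ≠ 0 := by
    intro p
    unfold loopFactor
    split_ifs <;> simp [hX, h2]
  refine mul_ne_zero (mul_ne_zero (Finset.prod_ne_zero_iff.2 fun x _ => hlist _)
    (pow_ne_zero _ ?_)) ?_
  · simp [Multiset.prod_eq_zero_iff, hloop]
  · simp [Multiset.prod_eq_zero_iff, hfac]

/-! ### The separating map and linear independence. -/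

/-- The linear map that sends a diagram to its shape, multiplied by its scalar. -/
noncomputable def shapeMap (κ : A) (k : ℕ) :
    DiagramModule k →ₗ[ℤ[X]] (Set.range (PreDiagram.shape (k := k)) →₀ A) :=
  Finsupp.linearCombination ℤ[X] (fun d : PreDiagram Omega k =>
    Finsupp.single ⟨d.shape, d, rfl⟩ (d.scalar κ)) ∘ₗ
    (MonoidAlgebra.coeffLinearEquiv ℤ[X]).toLinearMap

theorem shapeMap_ofDiagram (κ : A) (d : PreDiagram Omega k) :
    shapeMap κ k (ofDiagram d) = Finsupp.single ⟨d.shape, d, rfl⟩ (d.scalar κ) := by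
  change Finsupp.linearCombination ℤ[X] _ (Finsupp.single d 1) = _
  simp

theorem shapeMap_eq_zero {κ : A} {x : DiagramModule k} (hx : x ∈ congrSpan κ k) :
    shapeMap κ k x = 0 := by
  have : congrSpan κ k ≤ LinearMap.ker (shapeMap κ k) := by
    refine Submodule.span_le.2 ?_
    rintro x ⟨d, c, d', h, rfl⟩
    simp only [SetLike.mem_coe, LinearMap.mem_ker, map_sub, map_smul, shapeMap_ofDiagram,
      h.shape, h.scalar, Finsupp.smul_single, Algebra.smul_def, sub_self]
  exact this hx

theorem linearIndependent_diagramClass (k : ℕ) :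
    LinearIndependent ℤ[X] fun d : {d : PreDiagram Omega k // IsBasisDiagram d} =>
      diagramClass d.1 d.2.toIsLR := by
  -- This field contains `ℤ[δ]` and a fourth root of two.
  let A := AlgebraicClosure (FractionRing ℤ[X])
  have hinj : Function.Injective (algebraMap ℤ[X] A) := by
    rw [IsScalarTower.algebraMap_eq ℤ[X] (FractionRing ℤ[X]) A]
    exact (algebraMap (FractionRing ℤ[X]) A).injective.comp (IsFractionRing.injective _ _)
  have h2 : (2 : A) ≠ 0 := by
    rw [← map_ofNat (algebraMap ℤ[X] A) 2]
    exact (map_ne_zero_iff _ hinj).2 two_ne_zero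
  have hX : algebraMap ℤ[X] A X ≠ 0 := (map_ne_zero_iff _ hinj).2 X_ne_zero
  obtain ⟨κ, hκ⟩ := IsAlgClosed.exists_pow_nat_eq (2 : A) (n := 4) (by norm_num)
  let f : QuotientAlgebra k →ₗ[ℤ[X]] (Set.range (PreDiagram.shape (k := k)) →₀ A) :=
    ((relationIdeal k).submoduleOf (lrSpan k)).liftQ (shapeMap κ k ∘ₗ (lrSpan k).subtype) (by
      intro x hx
      exact shapeMap_eq_zero (relationIdeal_le_congrSpan hκ h2 k hx))
  have hf : ∀ (d : PreDiagram Omega k) (hd : IsLR d), f (diagramClass d hd) =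
      Finsupp.single ⟨d.shape, d, rfl⟩ (d.scalar κ) := fun d _ => shapeMap_ofDiagram κ d
  refine LinearIndependent.of_comp f ?_
  rw [linearIndependent_iff']
  intro s g hg d hd
  -- Evaluation at the shape of `d` isolates the coefficient of `d`, since no other basis diagram
  -- has that shape.
  have h3 := DFunLike.congr_fun hg ⟨d.1.shape, d.1, rfl⟩
  simp only [Function.comp_apply, hf, Finsupp.smul_single, Finsupp.coe_finsetSum,
    Finset.sum_apply, Finsupp.coe_zero, Pi.zero_apply] at h3
  rw [Finset.sum_eq_single d, Finsupp.single_eq_same, Algebra.smul_def] at h3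
  · refine hinj ?_
    rw [map_zero]
    exact (mul_eq_zero.1 h3).resolve_right (PreDiagram.scalar_ne_zero hκ h2 hX _)
  · intro e _ hed
    refine Finsupp.single_eq_of_ne fun h => hed (Subtype.ext ?_)
    exact eq_of_shape_eq e.2 d.2 (congrArg Subtype.val h).symm
  · exact fun h => absurd hd h

end Independence

/-! ## Basis diagrams span -/

section Spanning

open Polynomial

variable {k : ℕ}

/-- `d` is a multiple of `d'` modulo the relations. -/
def Reduces (d d' : PreDiagram Omega k) : Prop :=
  ∃ c : ℤ[X], ofDiagram d - c • ofDiagram d' ∈ relationIdeal k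

theorem Reduces.trans {d d' d'' : PreDiagram Omega k} (h : Reduces d d') (h' : Reduces d' d'') :
    Reduces d d'' := by
  obtain ⟨c, hc⟩ := h
  obtain ⟨c', hc'⟩ := h'
  refine ⟨c * c', ?_⟩
  have := add_mem hc (Submodule.smul_mem _ c hc')
  rwa [smul_sub, smul_smul, sub_add_sub_cancel] at this

theorem DiagramRel.sub_mem {d d' : PreDiagram Omega k} {c : ℤ[X]} (h : DiagramRel d c d')
    (hd : IsLR d) (hd' : IsLR d') : ofDiagram d - c • ofDiagram d' ∈ relationIdeal k :=
  Submodule.mem_sInf.2 fun _ hJ => hJ.1 d c d' hd hd' h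

theorem DiagramRel.reduces {d d' : PreDiagram Omega k} {c : ℤ[X]} (h : DiagramRel d c d')
    (hd : IsLR d) (hd' : IsLR d') : Reduces d d' :=
  ⟨c, h.sub_mem hd hd'⟩

/-- A relation with coefficient one may be read from right to left; this is needed to expand a
triangle. -/
theorem DiagramRel.reduces_symm {d d' : PreDiagram Omega k} (h : DiagramRel d (C 1) d')
    (hd : IsLR d) (hd' : IsLR d') : Reduces d' d := by
  refine ⟨1, ?_⟩
  have := neg_mem (h.sub_mem hd hd')
  simpa using this

/-- Two adjacent decorations of the same type can be replaced by one. -/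
theorem exists_reduces_singleton (F : List Omega → PreDiagram Omega k) (b : Bool)
    (hLR : ∀ w, w ≠ [] → (∀ c ∈ w, c.isClosed = b) → IsLR (F w))
    (hrel : ∀ p u v q m, BlockRel u m v → DiagramRel (F (p ++ u ++ q)) (C m) (F (p ++ v ++ q)))
    (c c' : Omega) (hc : c.isClosed = b) (hc' : c'.isClosed = b) :
    ∃ e, e.isClosed = b ∧ Reduces (F [c, c']) (F [e]) := by
  have step : ∀ u v m, BlockRel u m v → (∀ c ∈ u, c.isClosed = b) → (∀ c ∈ v, c.isClosed = b) →
      Reduces (F u) (F v) := by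
    intro u v m h hu hv
    have := hrel [] u v [] m h
    simp only [List.nil_append, List.append_nil] at this
    exact this.reduces (hLR u (by cases h <;> simp) hu) (hLR v (by cases h <;> simp) hv)
  -- Two triangles are not the left side of a relation. Expanding the first one gives `▲▲ = ••▲ = 2
  -- •• = 2 ▲`, and likewise for open decorations.
  have tri : ∀ s t : Omega, s.isClosed = b → t.isClosed = b → BlockRel [s, s] 1 [t] →
      BlockRel [s, t] 2 [s] → Reduces (F [t, t]) (F [t]) := by
    intro s t hs ht h1 h2
    have h3 : Reduces (F [t, t]) (F [s, s, t]) :=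
      (hrel [] [s, s] [t] [t] 1 h1).reduces_symm (hLR _ (by simp) (by simp [hs, ht]))
        (hLR _ (by simp) (by simp [ht]))
    have h4 : Reduces (F [s, s, t]) (F [s, s]) :=
      (hrel [s] [s, t] [s] [] 2 h2).reduces (hLR _ (by simp) (by simp [hs, ht]))
        (hLR _ (by simp) (by simp [hs]))
    exact (h3.trans h4).trans (step _ _ _ h1 (by simp [hs]) (by simp [ht]))
  cases b <;> cases c <;> simp only [Omega.isClosed, reduceCtorEq] at hc <;> cases c' <;>
    simp only [Omega.isClosed, reduceCtorEq] at hc'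
  · exact ⟨.openTri, rfl, step _ _ _ .open_two (by simp [Omega.isClosed]) (by simp [Omega.isClosed])⟩
  · exact ⟨.circ, rfl, step _ _ _ .open_three (by simp [Omega.isClosed]) (by simp [Omega.isClosed])⟩
  · exact ⟨.circ, rfl, step _ _ _ .open_three' (by simp [Omega.isClosed]) (by simp [Omega.isClosed])⟩
  · exact ⟨.openTri, rfl, tri .circ .openTri rfl rfl .open_two .open_three⟩
  · exact ⟨.closedTri, rfl,
      step _ _ _ .closed_two (by simp [Omega.isClosed]) (by simp [Omega.isClosed])⟩
  · exact ⟨.bullet, rfl,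
      step _ _ _ .closed_three (by simp [Omega.isClosed]) (by simp [Omega.isClosed])⟩
  · exact ⟨.bullet, rfl,
      step _ _ _ .closed_three' (by simp [Omega.isClosed]) (by simp [Omega.isClosed])⟩
  · exact ⟨.closedTri, rfl, tri .bullet .closedTri rfl rfl .closed_two .closed_three⟩

/-! ### Replacing words -/

/-- Every type of decoration of `w'` occurs in `w`, and `w'` is sorted if `w` is. -/
structure WordLE (w w' : List Omega) : Prop where
  mem : ∀ c' ∈ w', ∃ c ∈ w, c.isClosed = c'.isClosed
  sorted : (w.Pairwise fun c c' => c'.isClosed = true → c.isClosed = true) →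
    w'.Pairwise fun c c' => c'.isClosed = true → c.isClosed = true

theorem WordLE.refl (w : List Omega) : WordLE w w := ⟨fun c hc => ⟨c, hc, rfl⟩, id⟩

/-- As `u` is non-empty, one of its letters can stand for every letter of `v` in all comparisons of
types. -/
theorem WordLE.of_block {p u v q : List Omega} {b : Bool} (hu : u ≠ [])
    (hub : ∀ c ∈ u, c.isClosed = b) (hvb : ∀ c ∈ v, c.isClosed = b) :
    WordLE (p ++ u ++ q) (p ++ v ++ q) := by
  obtain ⟨a, ha⟩ := List.exists_mem_of_ne_nil u hu
  have hab := hub a ha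
  constructor
  · intro c hc
    simp only [List.mem_append] at hc ⊢
    rcases hc with (hc | hc) | hc
    · exact ⟨c, Or.inl (Or.inl hc), rfl⟩
    · exact ⟨a, Or.inl (Or.inr ha), by rw [hab, hvb c hc]⟩
    · exact ⟨c, Or.inr hc, rfl⟩
  · simp only [List.pairwise_append, List.mem_append]
    rintro ⟨⟨h1, -, h2⟩, h3, h4⟩
    refine ⟨⟨h1, ?_, ?_⟩, h3, ?_⟩
    -- Inside `v` all letters have one type, so the sorting condition is automatic.
    · exact List.Pairwise.imp_of_mem (fun hc _ _ _ => by simp_all)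
        (List.pairwise_of_forall (R := fun _ _ => True) fun _ _ => trivial)
    · intro c hc c' hc'
      rw [hvb c' hc', ← hab]
      exact h2 c hc a ha
    · rintro c (hc | hc) c' hc'
      · exact h4 c (Or.inl hc) c' hc'
      · rw [hvb c hc, ← hab]
        exact h4 a (Or.inr ha) c' hc'

/-- The LR conditions on edges depend only on which types occur on each edge and on the order of
types along the faces. -/
theorem IsLR.of_wordLE {d d' : PreDiagram Omega k} (hd : IsLR d) (hd' : d'.IsDiagram)
    (hmate : d'.mate = d.mate) (hloops : d'.loops = d.loops)
    (hword : ∀ x, WordLE (d.word x) (d'.word x)) : IsLR d' where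
  toIsDiagram := hd'
  closed_exposed x c hc h := by
    obtain ⟨c', hc', h'⟩ := (hword x).mem c hc
    have := hd.closed_exposed x c' hc' (h'.trans h)
    simpa only [PreDiagram.LExposed, hmate] using this
  open_exposed x c hc h := by
    obtain ⟨c', hc', h'⟩ := (hword x).mem c hc
    have := hd.open_exposed x c' hc' (h'.trans h)
    simpa only [PreDiagram.RExposed, hmate] using this
  face_sorted h b := by
    have h1 : ¬ d.IsDammed := by
      simpa only [PreDiagram.IsDammed, PreDiagram.IsPropagating, hmate] using h
    have h2 := hd.face_sorted h1 b
    simp only [PreDiagram.faceWord, List.pairwise_flatMap, hmate] at h2 ⊢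
    refine ⟨fun i hi => ?_, h2.2.imp ?_⟩
    · have h3 := h2.1 i hi
      split_ifs at h3 ⊢
      · exact (hword _).sorted h3
      · exact List.Pairwise.nil
    · intro i j h3 c hc c' hc'
      split_ifs at h3 hc hc'
      · obtain ⟨e, he, hec⟩ := (hword _).mem c hc
        obtain ⟨e', he', hec'⟩ := (hword _).mem c' hc'
        rw [← hec, ← hec']
        exact h3 e he e' he'
      all_goals simp at hc hc'
  loop_sorted := by
    rw [hloops]
    simpa only [PreDiagram.IsDammed, PreDiagram.IsPropagating, hmate] using hd.loop_sorted

/-- The number of decorations on a loop. -/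
def LoopWord.length {X : Type} : LoopWord X → ℕ :=
  Quotient.lift List.length fun u v h => by
    rcases h with h | h
    · exact h.perm.length_eq
    · rw [← h.perm.length_eq, List.length_reverse]

@[simp] theorem LoopWord.length_mk {X : Type} (u : List X) :
    (LoopWord.mk u).length = u.length := rfl

/-- The number of decorations and loops of a diagram, with multiplicities. -/
def PreDiagram.size (d : PreDiagram Omega k) : ℕ :=
  ∑ x, (d.word x).length + d.order.length + (d.loops.map fun l => l.length + 1).sum

/-- Replace the word on the edge at `x`. -/
def PreDiagram.setWord (d : PreDiagram Omega k) (x : BoxNode k) (w : List Omega) :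
    PreDiagram Omega k where
  mate := d.mate
  word y := if y = x then w else if y = d.mate x then w.reverse else d.word y
  order := d.order
  loops := d.loops

theorem PreDiagram.IsDiagram.setWord_self {d : PreDiagram Omega k} (hd : d.IsDiagram)
    (x : BoxNode k) : d.setWord x (d.word x) = d := by
  have : (d.setWord x (d.word x)).word = d.word := by
    funext y
    simp only [setWord]
    split_ifs with h1 h2
    · rw [h1]
    · rw [h2, hd.word_mate]
    · rfl
  cases d
  simp only [setWord, mk.injEq, true_and, and_true] at this ⊢
  exact this

/-- A decorated edge rules out `a`-value `0`. For `a`-value `1` the edge is non-propagating, so the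
vertical order is not affected. -/
theorem PreDiagram.IsDiagram.setWord {d : PreDiagram Omega k} (hd : d.IsDiagram) {x : BoxNode k}
    (hx : IsSingleBlock d x) (hne : d.word x ≠ []) (w : List Omega) :
    (d.setWord x w).IsDiagram where
  mate_mate := hd.mate_mate
  mate_ne := hd.mate_ne
  noncrossing := hd.noncrossing
  word_mate y := by
    have hinj : ∀ y, d.mate y = d.mate x ↔ y = x := fun y =>
      (Function.Involutive.injective hd.mate_mate).eq_iff
    have hmate : ∀ y, d.mate y = x ↔ y = d.mate x := fun y =>
      ⟨fun h => by rw [← h, hd.mate_mate], fun h => by rw [h, hd.mate_mate]⟩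
    simp only [PreDiagram.setWord, hinj, hmate]
    by_cases h1 : y = x
    · subst h1
      simp [(hd.mate_ne y).symm]
    · by_cases h2 : y = d.mate x
      · simp [h2, hd.mate_ne x]
      · simp [h1, h2, hd.word_mate]
  undecorated h := absurd ((hd.undecorated h).1 x) hne
  order_isPropagating := hd.order_isPropagating
  word_eq_order ha i hi := by
    have h1 : ¬ d.IsPropagating x := hx ha
    have h2 : ¬ d.IsPropagating (d.mate x) := by
      rw [IsPropagating, hd.mate_mate]
      exact fun h => h1 h.symm
    have h3 : d.IsPropagating (north i) := hi
    have h4 : north i ≠ x := fun h => h1 (h ▸ h3)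
    have h5 : north i ≠ d.mate x := fun h => h2 (h ▸ h3)
    simp only [PreDiagram.setWord, if_neg h4, if_neg h5]
    exact hd.word_eq_order ha i h3
  order_eq_nil := hd.order_eq_nil

theorem IsLR.setWord {d : PreDiagram Omega k} (hd : IsLR d) {x : BoxNode k}
    (hx : IsSingleBlock d x) {p u q w : List Omega} {b : Bool} (hu : u ≠ [])
    (hub : ∀ c ∈ u, c.isClosed = b) (hwb : ∀ c ∈ w, c.isClosed = b)
    (hword : d.word x = p ++ u ++ q) : IsLR (d.setWord x (p ++ w ++ q)) := by
  refine hd.of_wordLE (hd.toIsDiagram.setWord hx (by simp [hword, hu]) _) rfl rfl fun y => ?_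
  simp only [PreDiagram.setWord]
  split_ifs with h1 h2
  · rw [h1, hword]
    exact .of_block hu hub hwb
  · rw [h2, hd.word_mate, hword]
    simp only [List.reverse_append, ← List.append_assoc]
    exact .of_block (by simpa using hu) (by simpa using hub) (by simpa using hwb)
  · exact .refl _

theorem IsLR.exists_reduces_of_word {d : PreDiagram Omega k} (hd : IsLR d) {x : BoxNode k}
    (hx : IsSingleBlock d x) {p q : List Omega} {c c' : Omega}
    (hword : d.word x = p ++ c :: c' :: q) (hc : c.isClosed = c'.isClosed) :
    ∃ d', IsLR d' ∧ d'.size < d.size ∧ Reduces d d' := by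
  have hword' : d.word x = p ++ [c, c'] ++ q := by simp [hword]
  have hLR : ∀ w, w ≠ [] → (∀ e ∈ w, e.isClosed = c'.isClosed) →
      IsLR (d.setWord x (p ++ w ++ q)) := fun w _ hw =>
    hd.setWord hx (by simp) (by simp [hc]) hw hword'
  obtain ⟨e, he, hred⟩ := exists_reduces_singleton (fun w => d.setWord x (p ++ w ++ q))
    c'.isClosed hLR (fun p' u v q' m h => by
      refine .edge _ _ x (p ++ p') u (q' ++ q) v m h hx rfl rfl rfl ?_ ?_ ?_ ?_
      · simp [PreDiagram.setWord]
      · simp [PreDiagram.setWord]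
      · simp [PreDiagram.setWord, hd.mate_ne x]
      · intro y h1 h2
        have h3 : y ≠ d.mate x := h2
        simp [PreDiagram.setWord, h1, h3]) c c' hc rfl
  simp only [← hword', hd.toIsDiagram.setWord_self] at hred
  refine ⟨_, hLR [e] (by simp) (by simpa using he), ?_, hred⟩
  have h1 : ∑ y, ((d.setWord x (p ++ [e] ++ q)).word y).length < ∑ y, (d.word y).length := by
    refine Finset.sum_lt_sum (fun y _ => ?_) ⟨x, Finset.mem_univ x, ?_⟩
    · simp only [PreDiagram.setWord]
      split_ifs with h1 h2
      · simp [h1, hword]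
      · simp [h2, hd.word_mate, hword]
      · rfl
    · simp [PreDiagram.setWord, hword]
  simp only [PreDiagram.size]
  simp only [PreDiagram.setWord] at h1 ⊢
  omega

/-! ### Replacing the vertical order -/

/-- The letters of a vertical order that belong to the edge of the `i`-th north node. -/
def orderWord (o : List (Fin k × Omega)) (i : Fin k) : List Omega :=
  (o.filter fun p => p.1 = i).map Prod.snd

/-- Replace the vertical order of the decorations on propagating edges. -/
def PreDiagram.setOrder (d : PreDiagram Omega k) (o : List (Fin k × Omega)) :
    PreDiagram Omega k where
  mate := d.mate
  word y := if (d.mate y).1 = y.1 then d.word y else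
    if y.1 then (orderWord o (d.mate y).2).reverse else orderWord o y.2
  order := o
  loops := d.loops

theorem PreDiagram.IsDiagram.word_of_isPropagating {d : PreDiagram Omega k} (hd : d.IsDiagram)
    (ha : d.aValue = 1) {y : BoxNode k} (hy : d.IsPropagating y) :
    d.word y = if y.1 then (orderWord d.order (d.mate y).2).reverse
      else orderWord d.order y.2 := by
  obtain ⟨b, j⟩ := y
  cases b
  · exact hd.word_eq_order ha j hy
  · have h3 : d.mate (true, j) = north (d.mate (true, j)).2 := by
      simp only [IsPropagating, ne_eq, Bool.not_eq_true] at hy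
      exact Prod.ext hy rfl
    have h4 : d.IsPropagating (north (d.mate (true, j)).2) := by
      rw [← h3, IsPropagating, hd.mate_mate]
      exact fun h => hy h.symm
    have h5 := hd.word_eq_order ha _ h4
    have h6 := hd.word_mate (d.mate (true, j))
    rw [hd.mate_mate] at h6
    rw [← h3] at h5
    rw [h6, h5]
    rfl

theorem PreDiagram.IsDiagram.setOrder_self {d : PreDiagram Omega k} (hd : d.IsDiagram)
    (ha : d.aValue = 1) : d.setOrder d.order = d := by
  have : (d.setOrder d.order).word = d.word := by
    funext y
    simp only [setOrder]
    split_ifs with h1 h2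
    · rfl
    · rw [hd.word_of_isPropagating ha h1, if_pos h2]
    · rw [hd.word_of_isPropagating ha h1, if_neg h2]
  cases d
  simp only [setOrder, mk.injEq, true_and, and_true] at this ⊢
  exact this

theorem PreDiagram.IsDiagram.setOrder {d : PreDiagram Omega k} (hd : d.IsDiagram)
    (ha : d.aValue = 1) {o : List (Fin k × Omega)}
    (ho : ∀ p ∈ o, d.IsPropagating (north p.1)) : (d.setOrder o).IsDiagram where
  mate_mate := hd.mate_mate
  mate_ne := hd.mate_ne
  noncrossing := hd.noncrossing
  word_mate y := by
    simp only [PreDiagram.setOrder, hd.mate_mate]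
    by_cases h1 : (d.mate y).1 = y.1
    · rw [if_pos h1.symm, if_pos h1, hd.word_mate]
    · rw [if_neg (fun h => h1 h.symm), if_neg h1]
      cases hy : y.1 <;> cases hy' : (d.mate y).1 <;> simp_all
  undecorated h := by
    have : d.aValue = 0 := h
    omega
  order_isPropagating := ho
  word_eq_order _ i hi := by
    have h : ¬ (d.mate (north i)).1 = false := hi
    simp only [PreDiagram.setOrder, h, if_false, Bool.false_eq_true]
    rfl
  order_eq_nil h := absurd ha h

theorem orderWord_block (p q : List (Fin k × Omega)) (w : List Omega) (i j : Fin k) :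
    orderWord (p ++ w.map (fun c => (i, c)) ++ q) j =
      orderWord p j ++ (if i = j then w else []) ++ orderWord q j := by
  simp only [orderWord, List.filter_append, List.map_append]
  congr 2
  split_ifs with hij <;> simp [List.filter_map, Function.comp_def, hij]

theorem IsLR.setOrder {d : PreDiagram Omega k} (hd : IsLR d) (ha : d.aValue = 1)
    {p q : List (Fin k × Omega)} {i : Fin k} {u w : List Omega} {b : Bool} (hu : u ≠ [])
    (hub : ∀ c ∈ u, c.isClosed = b) (hwb : ∀ c ∈ w, c.isClosed = b)
    (horder : d.order = p ++ u.map (fun c => (i, c)) ++ q) :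
    IsLR (d.setOrder (p ++ w.map (fun c => (i, c)) ++ q)) := by
  refine hd.of_wordLE (hd.toIsDiagram.setOrder ha ?_) rfl rfl fun y => ?_
  · have h1 := hd.order_isPropagating
    rw [horder] at h1
    obtain ⟨a, hua⟩ := List.exists_mem_of_ne_nil u hu
    intro r hr
    simp only [List.mem_append, List.mem_map] at hr h1
    rcases hr with (hr | ⟨c, -, rfl⟩) | hr
    · exact h1 r (Or.inl (Or.inl hr))
    · exact h1 (i, a) (Or.inl (Or.inr ⟨a, hua, rfl⟩))
    · exact h1 r (Or.inr hr)
  · have key : ∀ j, WordLE (orderWord d.order j)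
          (orderWord (p ++ w.map (fun c => (i, c)) ++ q) j) ∧
        WordLE (orderWord d.order j).reverse
          (orderWord (p ++ w.map (fun c => (i, c)) ++ q) j).reverse := by
      intro j
      rw [horder, orderWord_block, orderWord_block]
      split_ifs
      · refine ⟨.of_block hu hub hwb, ?_⟩
        simp only [List.reverse_append, ← List.append_assoc]
        exact .of_block (by simpa using hu) (by simpa using hub) (by simpa using hwb)
      · exact ⟨.refl _, .refl _⟩
    simp only [PreDiagram.setOrder]
    split_ifs with h1 h2
    · exact .refl _
    · rw [hd.toIsDiagram.word_of_isPropagating ha h1, if_pos h2]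
      exact (key _).2
    · rw [hd.toIsDiagram.word_of_isPropagating ha h1, if_neg h2]
      exact (key _).1

theorem IsLR.exists_reduces_of_order {d : PreDiagram Omega k} (hd : IsLR d)
    {p q : List (Fin k × Omega)} {i : Fin k} {c c' : Omega}
    (horder : d.order = p ++ (i, c) :: (i, c') :: q) (hc : c.isClosed = c'.isClosed) :
    ∃ d', IsLR d' ∧ d'.size < d.size ∧ Reduces d d' := by
  -- A vertical order is recorded only for this `a`-value, so a non-empty one forces it.
  have ha : d.aValue = 1 := by
    by_contra h
    have := hd.order_eq_nil h
    simp [horder] at this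
  have horder' : d.order = p ++ [c, c'].map (fun c => (i, c)) ++ q := by simp [horder]
  have hLR : ∀ w, w ≠ [] → (∀ e ∈ w, e.isClosed = c'.isClosed) →
      IsLR (d.setOrder (p ++ w.map (fun c => (i, c)) ++ q)) := fun w _ hw =>
    hd.setOrder ha (by simp) (by simp [hc]) hw horder'
  obtain ⟨e, he, hred⟩ := exists_reduces_singleton
    (fun w => d.setOrder (p ++ w.map (fun c => (i, c)) ++ q))
    c'.isClosed hLR (fun p' u v q' m h => by
      refine .block _ _ i (p ++ p'.map fun c => (i, c)) ((q'.map fun c => (i, c)) ++ q) u v m h ha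
        rfl rfl ?_ ?_ ?_
      · simp [PreDiagram.setOrder]
      · simp [PreDiagram.setOrder]
      · intro y hy
        have h1 : (d.mate y).1 = y.1 := not_not.1 hy
        simp [PreDiagram.setOrder, h1]) c c' hc rfl
  simp only [← horder', hd.toIsDiagram.setOrder_self ha] at hred
  refine ⟨_, hLR [e] (by simp) (by simpa using he), ?_, hred⟩
  have hle : ∀ j, (orderWord (p ++ [e].map (fun c => (i, c)) ++ q) j).length ≤
      (orderWord d.order j).length := by
    intro j
    rw [horder', orderWord_block, orderWord_block]
    split_ifs <;> simp
  have h1 : ∑ y, ((d.setOrder (p ++ [e].map (fun c => (i, c)) ++ q)).word y).length ≤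
      ∑ y, (d.word y).length := by
    refine Finset.sum_le_sum fun y _ => ?_
    simp only [PreDiagram.setOrder]
    split_ifs with h1 h2
    · rfl
    · rw [hd.toIsDiagram.word_of_isPropagating ha h1, if_pos h2]
      simpa using hle _
    · rw [hd.toIsDiagram.word_of_isPropagating ha h1, if_neg h2]
      exact hle _
  have h2 : (p ++ [e].map (fun c => (i, c)) ++ q).length < d.order.length := by
    simp [horder]
  simp only [PreDiagram.size]
  simp only [PreDiagram.setOrder] at h1 ⊢
  omega

/-! ### Replacing loops -/

/-- Replace the loops of a diagram. -/
def PreDiagram.setLoops (d : PreDiagram Omega k) (L : Multiset (LoopWord Omega)) :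
    PreDiagram Omega k :=
  { d with loops := L }

theorem IsLR.setLoops {d : PreDiagram Omega k} (hd : IsLR d) {L : Multiset (LoopWord Omega)}
    (h0 : d.aValue = 0 → ∀ l ∈ L, l = LoopWord.mk [])
    (hL : ∀ l ∈ L, l ∈ d.loops ∨ ∃ u v : List Omega, l = LoopWord.mk (u ++ v) ∧
      (∀ c ∈ u, c.isClosed = true) ∧ (∀ c ∈ v, c.isClosed = false) ∧
      (d.IsDammed → u = [] ∨ v = [])) : IsLR (d.setLoops L) where
  mate_mate := hd.mate_mate
  mate_ne := hd.mate_ne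
  noncrossing := hd.noncrossing
  word_mate := hd.word_mate
  undecorated h := ⟨(hd.undecorated h).1, h0 h⟩
  order_isPropagating := hd.order_isPropagating
  word_eq_order := hd.word_eq_order
  order_eq_nil := hd.order_eq_nil
  closed_exposed := hd.closed_exposed
  open_exposed := hd.open_exposed
  face_sorted := hd.face_sorted
  loop_sorted l hl := (hL l hl).elim (hd.loop_sorted l) id

theorem LoopWord.mk_append_comm {X : Type} (u v : List X) :
    LoopWord.mk (u ++ v) = LoopWord.mk (v ++ u) :=
  Quotient.sound (Or.inl List.isRotated_append)

/-- The hypothesis `hr` supplies a sorted representative for every replacement of the leading pair,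
including the intermediate words that arise when a triangle is expanded. -/
theorem IsLR.exists_reduces_of_loop {d : PreDiagram Omega k} (hd : IsLR d) {c c' : Omega}
    {r : List Omega} (hl : LoopWord.mk (c :: c' :: r) ∈ d.loops)
    (hc : c.isClosed = c'.isClosed)
    (hr : ∀ w : List Omega, w ≠ [] → (∀ e ∈ w, e.isClosed = c'.isClosed) →
      ∃ u v : List Omega, LoopWord.mk (w ++ r) = LoopWord.mk (u ++ v) ∧
      (∀ c ∈ u, c.isClosed = true) ∧ (∀ c ∈ v, c.isClosed = false) ∧
      (d.IsDammed → u = [] ∨ v = [])) :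
    ∃ d', IsLR d' ∧ d'.size < d.size ∧ Reduces d d' := by
  obtain ⟨L, hL⟩ := Multiset.exists_cons_of_mem hl
  have hLR : ∀ w, w ≠ [] → (∀ e ∈ w, e.isClosed = c'.isClosed) →
      IsLR (d.setLoops (LoopWord.mk (w ++ r) ::ₘ L)) := by
    intro w hw hw'
    refine hd.setLoops (fun h => ?_) fun l hl' => ?_
    -- For `a`-value `0` all loops are undecorated, but this one has at least two letters.
    · have := congrArg LoopWord.length ((hd.undecorated h).2 _ hl)
      simp at this
    · rcases Multiset.mem_cons.1 hl' with rfl | hl'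
      · exact Or.inr (hr w hw hw')
      · exact Or.inl (hL ▸ Multiset.mem_cons_of_mem hl')
  obtain ⟨e, he, hred⟩ := exists_reduces_singleton
    (fun w => d.setLoops (LoopWord.mk (w ++ r) ::ₘ L))
    c'.isClosed hLR (fun p u v q m h => by
      -- The rewritten block is rotated to the end of the loop word, where the `loop` relation
      -- expects it.
      have hrot : ∀ w : List Omega, LoopWord.mk (p ++ w ++ q ++ r) =
          LoopWord.mk (q ++ r ++ p ++ w) := by
        intro w
        have := LoopWord.mk_append_comm (p ++ w) (q ++ r)
        simpa only [List.append_assoc] using this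
      exact .loop _ _ (q ++ r ++ p) u v L m h rfl rfl rfl (by rw [← hrot]; rfl)
        (by rw [← hrot]; rfl)) c c' hc rfl
  have hself : d.setLoops (LoopWord.mk ([c, c'] ++ r) ::ₘ L) = d := by
    cases d
    simp only [PreDiagram.setLoops, PreDiagram.mk.injEq, true_and]
    exact hL.symm
  simp only [hself] at hred
  refine ⟨_, hLR [e] (by simp) (by simpa using he), ?_, hred⟩
  simp only [PreDiagram.size, PreDiagram.setLoops, hL]
  simp

theorem IsLR.exists_reduces_of_not_isAlternating {d : PreDiagram Omega k} (hd : IsLR d)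
    {w : List Omega} (hl : LoopWord.mk w ∈ d.loops) (hw : ¬ IsAlternating w) :
    ∃ d', IsLR d' ∧ d'.size < d.size ∧ Reduces d d' := by
  -- The given representative may be unsorted, so the argument passes to a sorted one. If its closed
  -- or open part has two letters, these are adjacent and can be merged; otherwise every
  -- representative alternates.
  obtain ⟨u, v, huv, hu, hv, hdam⟩ := hd.loop_sorted _ hl
  match u, v with
  | c :: c' :: u, v =>
    have hc : c.isClosed = true := hu c (by simp)
    have hc' : c'.isClosed = true := hu c' (by simp)
    rw [huv] at hl
    refine hd.exists_reduces_of_loop (r := u ++ v) hl (hc.trans hc'.symm) fun w _ hw' => ?_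
    refine ⟨w ++ u, v, by rw [List.append_assoc], ?_, hv, fun h => ?_⟩
    · intro e he
      rcases List.mem_append.1 he with he | he
      · exact (hw' e he).trans hc'
      · exact hu e (by simp [he])
    · exact Or.inr ((hdam h).resolve_left (by simp))
  | u, c :: c' :: v =>
    have hc : c.isClosed = false := hv c (by simp)
    have hc' : c'.isClosed = false := hv c' (by simp)
    rw [huv, LoopWord.mk_append_comm] at hl
    refine hd.exists_reduces_of_loop (r := v ++ u) hl (hc.trans hc'.symm) fun w _ hw' => ?_
    refine ⟨u, w ++ v, ?_, hu, ?_, fun h => ?_⟩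
    · rw [← List.append_assoc, LoopWord.mk_append_comm]
    · intro e he
      rcases List.mem_append.1 he with he | he
      · exact (hw' e he).trans hc'
      · exact hv e (by simp [he])
    · exact Or.inl ((hdam h).resolve_right (by simp))
  | [], [] | [], [_] | [_], [] =>
    have h1 := congrArg LoopWord.length huv
    match w with
    | [] | [_] => simp [IsAlternating] at hw
    | _ :: _ :: _ => simp at h1
  | [a], [b] =>
    have h1 := congrArg LoopWord.length huv
    match w with
    | [] | [_] | _ :: _ :: _ :: _ => simp at h1
    | [x, y] =>
      -- Rotation and reversal keep the multiset of letters, so a loop with one closed and one open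
      -- letter alternates however it is read.
      have h2 : [x, y].Perm [a, b] := by
        rcases Quotient.exact huv with h | h
        · exact h.perm
        · exact (List.reverse_perm _).symm.trans h.perm
      have h3 := h2.map Omega.isClosed
      simp only [List.map_cons, List.map_nil, hu a (by simp), hv b (by simp)] at h3
      have h4 : ∀ s t : Bool, [s, t].Perm [true, false] → s ≠ t := by decide
      exact absurd (by simpa [IsAlternating] using h4 _ _ h3) hw

theorem IsLR.exists_reduces_of_scalarLoop {d : PreDiagram Omega k} (hd : IsLR d)
    {w : List Omega} (hl : LoopWord.mk w ∈ d.loops) (hw : ScalarLoop w) :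
    ∃ d', IsLR d' ∧ d'.size < d.size ∧ Reduces d d' := by
  obtain ⟨L, hL⟩ := Multiset.exists_cons_of_mem hl
  have hmem : ∀ l ∈ L, l ∈ d.loops := fun l h => hL ▸ Multiset.mem_cons_of_mem h
  have hLR : IsLR (d.setLoops L) :=
    hd.setLoops (fun h l h' => (hd.undecorated h).2 l (hmem l h')) fun l h => Or.inl (hmem l h)
  refine ⟨_, hLR, ?_, DiagramRel.reduces (.removal _ _ w hw rfl rfl rfl hL) hd hLR⟩
  simp only [PreDiagram.size, PreDiagram.setLoops, hL]
  simp

/-! ### Termination of the reduction, and spanning. -/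

/-- An LR-decorated diagram that is not a basis diagram can be reduced. -/
theorem IsLR.isBasisDiagram_or_exists_reduces {d : PreDiagram Omega k} (hd : IsLR d) :
    IsBasisDiagram d ∨ ∃ d', IsLR d' ∧ d'.size < d.size ∧ Reduces d d' := by
  by_contra! h
  obtain ⟨h1, h2⟩ := h
  have h3 : ¬ ∃ d', IsLR d' ∧ d'.size < d.size ∧ Reduces d d' := by
    rintro ⟨d', h4, h5, h6⟩
    exact h2 d' h4 h5 h6
  refine h1 ⟨hd, fun x hx => ?_, ?_, fun w hl => ?_, fun w hl hw => ?_⟩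
  · refine List.isChain_iff_forall_rel_of_append_cons_cons.2 fun c c' p q hw hc => ?_
    exact h3 (hd.exists_reduces_of_word hx hw hc)
  · refine List.isChain_iff_forall_rel_of_append_cons_cons.2 ?_
    rintro ⟨i, c⟩ ⟨i', c'⟩ p q hw hi hc
    simp only at hi
    subst hi
    exact h3 (hd.exists_reduces_of_order hw hc)
  · by_contra hw
    exact h3 (hd.exists_reduces_of_not_isAlternating hl hw)
  · exact h3 (hd.exists_reduces_of_scalarLoop hl hw)

/-- By strong induction on `size`, which every reduction lowers. -/
theorem diagramClass_mem_span (d : PreDiagram Omega k) (hd : IsLR d) :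
    diagramClass d hd ∈ Submodule.span ℤ[X] (Set.range fun d :
      {d : PreDiagram Omega k // IsBasisDiagram d} => diagramClass d.1 d.2.toIsLR) := by
  induction hs : d.size using Nat.strong_induction_on generalizing d with
  | _ s ih =>
    rcases hd.isBasisDiagram_or_exists_reduces with h | ⟨d', hd', hlt, c, hc⟩
    · exact Submodule.subset_span ⟨⟨d, h⟩, rfl⟩
    · have h1 : diagramClass d hd = c • diagramClass d' hd' := by
        rw [diagramClass, diagramClass, ← Submodule.Quotient.mk_smul, Submodule.Quotient.eq]
        exact hc
      rw [h1]
      exact Submodule.smul_mem _ _ (ih _ (hs ▸ hlt) d' hd' rfl)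

theorem span_diagramClass (k : ℕ) :
    ⊤ ≤ Submodule.span ℤ[X] (Set.range fun d :
      {d : PreDiagram Omega k // IsBasisDiagram d} => diagramClass d.1 d.2.toIsLR) := by
  rintro x -
  obtain ⟨⟨x, hx⟩, rfl⟩ := Submodule.Quotient.mk_surjective _ x
  induction hx using Submodule.span_induction with
  | mem x h =>
    obtain ⟨d, hd, rfl⟩ := h
    exact diagramClass_mem_span d hd
  | zero => exact zero_mem _
  | add x y hx hy h1 h2 => exact add_mem h1 h2
  | smul c x hx h => exact Submodule.smul_mem _ c h

end Spanning

theorem mainTheorem4 (n : ℕ) (hn : 2 ≤ n) :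
    ∃ b : Module.Basis {d : PreDiagram Omega (n + 2) // IsBasisDiagram d} (Polynomial ℤ)
        (QuotientAlgebra (n + 2)),
      ∀ d, b d = diagramClass d.1 d.2.toIsLR :=
  ⟨Module.Basis.mk (linearIndependent_diagramClass _) (span_diagramClass _), fun d => by
    rw [Module.Basis.mk_apply]⟩
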